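/- Notation. For real $q$ put $[n]_q=1+q+\dots+q^{n-1}$ ($[0]_q=0$), $[n]_q!=\prod_{i=1}^n[i]_q$, and $\begin{bmatrix}n\\k\end{bmatrix}_q=\frac{[n]_q!}{[k]_q!\,[n-k]_q!}$ for $0\le k\le n$. For $|q|<1$ put $(a|q)_\infty=\prod_{k=0}^\infty(1-aq^k)$ and write $(a)_\infty$ for $(a|q)_\infty$. Let $U_n$ be the Chebyshev polynomials of the second kind, $U_n(\cos\theta)=\sin((n+1)\theta)/\sin\theta$. For $q\in(-1,1)$ the $q$-Gaussian density is $$f_H(x|q)=\frac{\sqrt{1-q}}{2\pi\sqrt{4-(1-q)x^2}}\prod_{k=0}^\infty\left((1+q^k)^2-(1-q)x^2q^k\right)\prod_{k=0}^\infty(1-q^{k+1}),\qquad |x|\le\frac{2}{\sqrt{1-q}},$$ where at the end points $x=\pm 2/\sqrt{1-q}$ the value is understood as the limit $0$. **Corollary.** For every $q\in(-1,1)$ all infinite products and series in i)–iv) converge, and: i) for all $x\in\left[-\frac{2}{\sqrt{1-q}},\frac{2}{\sqrt{1-q}}\right]$, $$(q)_\infty\prod_{k=1}^\infty\left((1+q^k)^2-(1-q)x^2q^k\right)=\sum_{k=1}^\infty(-1)^{k-1}q^{\binom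 k2}U_{2k-2}\!\left(\frac{x\sqrt{1-q}}{2}\right);$$ ii) $\displaystyle(-q)_\infty\,(q^2|q^2)_\infty=\sum_{k=1}^\infty q^{\binom k2}$; iii) $\displaystyle(q^3|q^3)_\infty=1+\sum_{k=1}^\infty(-1)^{3k}\left(q^{\binom{3k}2}+q^{\binom{3k+1}2}\right)$; iv) $\displaystyle(q)_\infty^3=1+\sum_{k=2}^\infty(-1)^{k+1}(2k-1)\,q^{\binom k2}$; v) for all integers $n\ge1$, $$\begin{bmatrix}2n\\n\end{bmatrix}_q=\sum_{k=1}^n(-1)^{k-1}(1+q^k)\,q^{\binom k2}\begin{bmatrix}2n\\n-k\end{bmatrix}_q.$$ vi) The equation $\sum_{k=0}^\infty(2k+1)^2q^{k(k+1)/2}=0$ has a largest real root $q_0$; it satisfies $-0.108<q_0<-0.107$, and for every $q\in(-1,q_0)$ the density $x\mapsto f_H(x|q)$ is bimodal, i.e. it has exactly two modes $m_1<m_2$: on $[-2/\sqrt{1-q},\,2/\sqrt{1-q}]$ there are interior points $m_1<c<m_2$ such that $f_H(\cdot|q)$ is strictly increasing up to $m_1$, strictly decreasing from $m_1$ to $c$,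 strictly increasing from $c$ to $m_2$ and strictly decreasing from $m_2$ on. (A root is a real $q$ at which the series converges to $0$.) -/

import Mathlib

open Set

namespace QGaussian

noncomputable section

/-- The `q`-number `[n]_q = 1 + q + ... + q^(n-1)`, with `[0]_q = 0`. -/
def qNumber (q : ℝ) (n : ℕ) : ℝ := ∑ i ∈ Finset.range n, q ^ i

/-- The `q`-factorial `[n]_q! = [1]_q [2]_q ... [n]_q`, with `[0]_q! = 1`. -/
def qFactorial (q : ℝ) (n : ℕ) : ℝ := ∏ i ∈ Finset.Icc 1 n, qNumber q i

/-- The `q`-binomial coefficient `[n]_q! / ([k]_q! [n-k]_q!)` for `k ≤ n`, and `0` otherwise. -/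
def qBinom (q : ℝ) (n k : ℕ) : ℝ :=
  if k ≤ n then qFactorial q n / (qFactorial q k * qFactorial q (n - k)) else 0

/-- The infinite `q`-Pochhammer symbol `(a|q)_∞ = ∏_{k ≥ 0} (1 - a q^k)`
(the product converges for `|q| < 1`, see `multipliable_qPochhammerInf`). -/
def qPochhammerInf (a q : ℝ) : ℝ := ∏' k : ℕ, (1 - a * q ^ k)

/-- The density `f_H(x|q)` of the `q`-Gaussian distribution, `-1 < q < 1`, which is supported on
`|x| ≤ 2/√(1-q)`. At the two end points, where the formula reads `0/0`, the value is the limit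
value `0`; see `density_endpoint`. -/
def density (q x : ℝ) : ℝ :=
  if |x| ≤ 2 / √(1 - q) then
    √(1 - q) / (2 * Real.pi * √(4 - (1 - q) * x ^ 2))
      * (∏' k : ℕ, ((1 + q ^ k) ^ 2 - (1 - q) * x ^ 2 * q ^ k))
      * (∏' k : ℕ, (1 - q ^ (k + 1)))
  else 0

/-- `f` is bimodal on the interval `s`: it has exactly two modes `m₁ < m₂` there, that is,
for some `c` between them it strictly increases up to `m₁`, strictly decreases from `m₁` to `c`,
strictly increases from `c` to `m₂` and strictly decreases from `m₂` on. -/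
def IsBimodalOn (f : ℝ → ℝ) (s : Set ℝ) : Prop :=
  ∃ m₁ c m₂ : ℝ, m₁ ∈ interior s ∧ m₂ ∈ interior s ∧ m₁ < c ∧ c < m₂ ∧
    StrictMonoOn f (s ∩ Iic m₁) ∧ StrictAntiOn f (s ∩ Icc m₁ c) ∧
    StrictMonoOn f (s ∩ Icc c m₂) ∧ StrictAntiOn f (s ∩ Ici m₂)

theorem multipliable_qPochhammerInf (a q : ℝ) (hq : q ∈ Ioo (-1 : ℝ) 1) :
    Multipliable (fun k : ℕ => 1 - a * q ^ k) := by
  have h : Summable (fun k : ℕ => -(a * q ^ k)) :=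
    ((summable_geometric_of_abs_lt_one (abs_lt.2 hq)).mul_left a).neg
  simpa [sub_eq_add_neg] using Real.multipliable_one_add_of_summable h

theorem multipliable_density (q x : ℝ) (hq : q ∈ Ioo (-1 : ℝ) 1) :
    Multipliable (fun k : ℕ => (1 + q ^ k) ^ 2 - (1 - q) * x ^ 2 * q ^ k) := by
  have h1 : Summable (fun k : ℕ => q ^ k) := summable_geometric_of_abs_lt_one (abs_lt.2 hq)
  have h2 : Summable (fun k : ℕ => (q ^ 2) ^ k) := by
    apply summable_geometric_of_abs_lt_one
    rw [abs_pow]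
    exact pow_lt_one₀ (abs_nonneg q) (abs_lt.2 hq) two_ne_zero
  have h : Summable (fun k : ℕ => (2 - (1 - q) * x ^ 2) * q ^ k + (q ^ 2) ^ k) :=
    (h1.mul_left _).add h2
  have h3 := Real.multipliable_one_add_of_summable h
  refine h3.congr fun k => ?_
  rw [← pow_mul, mul_comm 2 k, pow_mul]
  ring

theorem density_endpoint (q x : ℝ) (hx : |x| = 2 / √(1 - q)) (hq : q ∈ Ioo (-1 : ℝ) 1) :
    density q x = 0 := by
  have h : (1 - q) * x ^ 2 = 4 := by
    have h0 : 0 < 1 - q := by linarith [hq.2]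
    rw [← sq_abs, hx, div_pow, Real.sq_sqrt h0.le]
    field_simp
    norm_num
  simp [density, h]

end

end QGaussian

/-!
Everything rests on one finite identity,
`∏_{j=1}^n ((1+q^j)² - 4y²q^j) = ∑_{k≤n} (-1)^k q^(k(k+1)/2) [2n+1, n-k]_q U_{2k}(y)`
(`prod_eq_sum_shiftedQBinom`), which follows by induction on `n` from the `q`-Pascal rules and from
`4y²U_{2k} = U_{2k+2} + 2U_{2k} + U_{2k-2}`. As `n → ∞` the `q`-binomial coefficients stay bounded
and tend to `1/(q)_∞`, while `|U_{2k}| ≤ 2k+1` on `[-1, 1]`; dominated convergence gives the triple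
product identity (`tripleProduct`). Its values at `y = 0, 1/2, 1` are the identities for
`∑ q^(k(k-1)/2)`, `(q³|q³)_∞` and `(q)_∞³`. The central `q`-binomial identity is separate and
finite: the `q`-Pascal rules make the alternating sum telescope (`qBinom_central`).

For bimodality, put `t = (1-q)x²`. Up to a constant the density is
`F(t) = √(4-t) ∏_{k≥1} ((1+q^k)² - t q^k)` on `[0, 4]`. Each factor is log-concave in `t` and the
square root strictly so; hence `F`, which vanishes at `4`, first increases strictly and then
decreases strictly as soon as it exceeds `F(0)` somewhere (`exists_profile_unimodal`). This happens
when `F'(0) > 0`, and the product gives `F'(0)/F(0) = -(1/8 + S(q))` with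
`S(q) = ∑_{k≥1} q^k/(1+q^k)²` (`hasDerivAt_logProfile`). On the other hand the triple product
identity turns `F(4 sin²φ)` into a multiple of `∑ q^(k(k+1)/2) cos((2k+1)φ)`, whose second
derivative at `0` is minus the series `∑ (2k+1)² q^(k(k+1)/2)`. So that series is a positive
multiple of `1/8 + S(q)` (`tsum_sq_mul_pow_choose`), and `S(q₀) = -1/8` at its zero `q₀`.
Finally `S` is strictly increasing on `(-1, 0]` (`lambertSum_strictMonoOn`), so `F'(0) > 0` for
every `q < q₀`. The zero is located between `-0.108` and `-0.107` by the first three terms of the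
series and the intermediate value theorem.
-/

namespace QGaussian

open Filter Topology

/-! ### `q`-numbers, `q`-binomial coefficients and the central identity -/

theorem qNumber_mul_one_sub (q : ℝ) (n : ℕ) : qNumber q n * (1 - q) = 1 - q ^ n := by
  have := geom_sum_mul q n
  unfold qNumber
  linarith

theorem qNumber_pos {q : ℝ} (hq : q ∈ Ioo (-1 : ℝ) 1) {n : ℕ} (hn : n ≠ 0) :
    0 < qNumber q n := by
  have h1 : 0 < 1 - q := by linarith [hq.2]
  have h2 : q ^ n < 1 :=
    (le_abs_self _).trans_lt (by rw [abs_pow]; exact pow_lt_one₀ (abs_nonneg q) (abs_lt.2 hq) hn)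
  have h3 := qNumber_mul_one_sub q n
  exact pos_of_mul_pos_left (by rw [h3]; linarith) h1.le

theorem qNumber_add (q : ℝ) (m n : ℕ) : qNumber q (m + n) = qNumber q m + q ^ m * qNumber q n := by
  unfold qNumber
  rw [Finset.sum_range_add, Finset.mul_sum]
  simp only [pow_add]

theorem qFactorial_zero (q : ℝ) : qFactorial q 0 = 1 := by simp [qFactorial]

theorem qFactorial_succ (q : ℝ) (n : ℕ) :
    qFactorial q (n + 1) = qFactorial q n * qNumber q (n + 1) := by
  unfold qFactorial
  rw [Finset.prod_Icc_succ_top (by omega)]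

theorem qFactorial_pos {q : ℝ} (hq : q ∈ Ioo (-1 : ℝ) 1) (n : ℕ) : 0 < qFactorial q n :=
  Finset.prod_pos fun i hi => qNumber_pos hq (by have := (Finset.mem_Icc.1 hi).1; omega)

theorem qBinom_zero_right {q : ℝ} (hq : q ∈ Ioo (-1 : ℝ) 1) (n : ℕ) : qBinom q n 0 = 1 := by
  simp [qBinom, qFactorial_zero, (qFactorial_pos hq n).ne']

theorem qBinom_self {q : ℝ} (hq : q ∈ Ioo (-1 : ℝ) 1) (n : ℕ) : qBinom q n n = 1 := by
  simp [qBinom, qFactorial_zero, (qFactorial_pos hq n).ne']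

theorem qBinom_of_lt (q : ℝ) {n k : ℕ} (h : n < k) : qBinom q n k = 0 := by
  simp [qBinom, h]

theorem qBinom_add (q : ℝ) (a b : ℕ) :
    qBinom q (a + b) a = qFactorial q (a + b) / (qFactorial q a * qFactorial q b) := by
  simp [qBinom]

theorem qBinom_add_comm (q : ℝ) (a b : ℕ) : qBinom q (a + b) a = qBinom q (a + b) b := by
  rw [qBinom_add, add_comm a b, qBinom_add, mul_comm (qFactorial q a)]

/-- The `q`-Pascal rule `[n+1, k+1] = [n, k] + q^(k+1) [n, k+1]`. -/
theorem qBinom_succ_succ {q : ℝ} (hq : q ∈ Ioo (-1 : ℝ) 1) (n k : ℕ) :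
    qBinom q (n + 1) (k + 1) = qBinom q n k + q ^ (k + 1) * qBinom q n (k + 1) := by
  rcases lt_trichotomy n k with h | rfl | h
  · rw [qBinom_of_lt q h, qBinom_of_lt q (by omega), qBinom_of_lt q (by omega)]
    simp
  · rw [qBinom_self hq, qBinom_self hq, qBinom_of_lt q (by omega)]
    simp
  · obtain ⟨j, rfl⟩ : ∃ j, n = k + 1 + j := ⟨n - (k + 1), by omega⟩
    rw [qBinom_add, show k + 1 + j + 1 = (k + 1) + (j + 1) by ring, qBinom_add,
      show k + 1 + j = k + (j + 1) by ring, qBinom_add, show k + (j + 1) = k + 1 + j by ring,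
      show k + 1 + (j + 1) = (k + 1 + j) + 1 by ring, qFactorial_succ q (k + 1 + j),
      qFactorial_succ q k, qFactorial_succ q j, show k + 1 + j + 1 = (k + 1) + (j + 1) by ring,
      qNumber_add]
    have h1 := (qFactorial_pos hq k).ne'
    have h2 := (qFactorial_pos hq j).ne'
    have h3 := (qNumber_pos hq (Nat.succ_ne_zero k)).ne'
    have h4 := (qNumber_pos hq (Nat.succ_ne_zero j)).ne'
    simp only [Nat.succ_eq_add_one] at h3 h4
    field_simp

/-- The `q`-Pascal rule `[n+1, k+1] = q^(n-k) [n, k] + [n, k+1]`, with `n = k + j`. -/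
theorem qBinom_succ_succ' {q : ℝ} (hq : q ∈ Ioo (-1 : ℝ) 1) (k j : ℕ) :
    qBinom q (k + j + 1) (k + 1) = q ^ j * qBinom q (k + j) k + qBinom q (k + j) (k + 1) := by
  rcases j with _ | j
  · rw [add_zero, qBinom_self hq, qBinom_self hq, qBinom_of_lt q (by omega)]
    simp
  · rw [show k + (j + 1) + 1 = (k + 1) + (j + 1) by ring, qBinom_add_comm,
      show k + 1 + (j + 1) = (k + (j + 1)) + 1 by ring, qBinom_succ_succ hq, ← qBinom_add_comm,
      show k + (j + 1) = (k + 1) + j by ring, ← qBinom_add_comm q (k + 1) j]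
    ring

/-- Both `q`-Pascal rules in turn, going from `N + 2` down to `N = j + i + 1`. -/
theorem qBinom_add_two {q : ℝ} (hq : q ∈ Ioo (-1 : ℝ) 1) (i j : ℕ) :
    qBinom q (j + i + 1 + 2) (j + 2) =
      (1 + q ^ (j + i + 2)) * qBinom q (j + i + 1) (j + 1) +
        q ^ (j + 2) * qBinom q (j + i + 1) (j + 2) + q ^ (i + 1) * qBinom q (j + i + 1) j := by
  have h1 := qBinom_succ_succ hq (j + i + 2) (j + 1)
  have h2 := qBinom_succ_succ' hq j (i + 1)
  have h3 := qBinom_succ_succ' hq (j + 1) i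
  rw [show j + (i + 1) + 1 = j + i + 2 by ring, show j + (i + 1) = j + i + 1 by ring] at h2
  rw [show j + 1 + i + 1 = j + i + 2 by ring, show j + 1 + i = j + i + 1 by ring] at h3
  rw [show j + i + 1 + 2 = j + i + 2 + 1 by ring, show j + 2 = j + 1 + 1 by ring, h1, h2, h3]
  ring

theorem choose_succ_two (k : ℕ) : Nat.choose (k + 1) 2 = Nat.choose k 2 + k := by
  rw [Nat.choose_succ_succ' k 1, Nat.choose_one_right, add_comm]

/-- The `q`-Pascal rules turn the `k`-th term into a sum of two consecutive terms of one sequence,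
so that the alternating sum telescopes. -/
theorem qBinom_central {q : ℝ} (hq : q ∈ Ioo (-1 : ℝ) 1) (n : ℕ) (hn : 1 ≤ n) :
    qBinom q (2 * n) n =
      ∑ k ∈ Finset.Icc 1 n, (-1 : ℝ) ^ (k - 1) * (1 + q ^ k) * q ^ (Nat.choose k 2) *
        qBinom q (2 * n) (n - k) := by
  obtain ⟨N, rfl⟩ : ∃ N, n = N + 1 := ⟨n - 1, by omega⟩
  -- For `k > N` the truncated `N - k` would give the value `1` instead of `0`.
  let d : ℕ → ℝ := fun k =>
    if k ≤ N then q ^ (Nat.choose (k + 1) 2) * qBinom q (2 * N + 1) (N - k) else 0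
  have key : ∀ k ≤ N, (1 + q ^ (k + 1)) * q ^ (Nat.choose (k + 1) 2) *
      qBinom q (2 * (N + 1)) (N - k) = (1 + q ^ (N + 1)) * (d k + d (k + 1)) := by
    intro k hk
    rcases hk.eq_or_lt with rfl | hk
    · simp only [d, le_refl, if_true, Nat.sub_self, qBinom_zero_right hq]
      simp
    · obtain ⟨j, rfl⟩ : ∃ j, N = k + 1 + j := ⟨N - (k + 1), by omega⟩
      have e1 : k + 1 + j - k = j + 1 := by omega
      have e2 : k + 1 + j - (k + 1) = j := by omega
      have h1 := qBinom_succ_succ hq (2 * (k + 1 + j) + 1) j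
      have h2 := qBinom_succ_succ' hq j (2 * (k + 1) + j + 1)
      rw [show j + (2 * (k + 1) + j + 1) = 2 * (k + 1 + j) + 1 by ring] at h2
      simp only [d, if_pos hk.le, if_pos (show k + 1 ≤ k + 1 + j by omega), e1, e2]
      rw [show 2 * (k + 1 + j + 1) = 2 * (k + 1 + j) + 1 + 1 by ring]
      rw [choose_succ_two (k + 1), pow_add q _ (k + 1)]
      calc _ = q ^ (Nat.choose (k + 1) 2) * (qBinom q (2 * (k + 1 + j) + 1 + 1) (j + 1)) +
            q ^ (k + 1) * q ^ (Nat.choose (k + 1) 2) *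
              (qBinom q (2 * (k + 1 + j) + 1 + 1) (j + 1)) := by ring
        _ = _ := by
            conv_lhs => enter [1]; rw [h2]
            rw [h1]
            ring
  have tele : ∀ m, ∑ k ∈ Finset.range m, (-1 : ℝ) ^ k * (d k + d (k + 1)) =
      d 0 - (-1) ^ m * d m := by
    intro m
    induction m with
    | zero => simp
    | succ m ih => rw [Finset.sum_range_succ, ih]; ring
  have hd : d (N + 1) = 0 := by simp [d]
  have hd0 : d 0 = qBinom q (2 * N + 1) N := by simp [d]
  have hsum : ∑ k ∈ Finset.Icc 1 (N + 1), (-1 : ℝ) ^ (k - 1) * (1 + q ^ k) *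
      q ^ (Nat.choose k 2) * qBinom q (2 * (N + 1)) (N + 1 - k) =
      ∑ k ∈ Finset.range (N + 1), (1 + q ^ (N + 1)) * ((-1 : ℝ) ^ k * (d k + d (k + 1))) :=
    Finset.sum_bij (fun k _ => k - 1)
    (fun k hk => by simp only [Finset.mem_Icc, Finset.mem_range] at *; omega)
    (fun a ha b hb h => by simp only [Finset.mem_Icc] at *; omega)
    (fun b hb => ⟨b + 1, by simp only [Finset.mem_Icc, Finset.mem_range] at *; omega, by simp⟩)
    (fun k hk => by
      obtain ⟨hk1, hk2⟩ := Finset.mem_Icc.1 hk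
      obtain ⟨i, rfl⟩ : ∃ i, k = i + 1 := ⟨k - 1, by omega⟩
      have := key i (by omega)
      rw [show N + 1 - (i + 1) = N - i by omega, Nat.add_sub_cancel, mul_assoc, mul_assoc,
        ← mul_assoc (1 + q ^ (i + 1)), this]
      ring)
  rw [hsum, ← Finset.mul_sum, tele, hd, hd0]
  have h := qBinom_succ_succ hq (2 * N + 1) N
  have hs := qBinom_add_comm q N (N + 1)
  rw [show N + (N + 1) = 2 * N + 1 by ring] at hs
  rw [show 2 * (N + 1) = 2 * N + 1 + 1 by ring, h, ← hs]
  ring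

/-! ### A finite form of the triple product identity -/

open Polynomial.Chebyshev in
theorem four_sq_mul_chebyshevU (y : ℝ) (n : ℤ) :
    4 * y ^ 2 * (U ℝ n).eval y =
      (U ℝ (n + 2)).eval y + 2 * (U ℝ n).eval y + (U ℝ (n - 2)).eval y := by
  have h1 := congrArg (Polynomial.eval y) (U_add_two ℝ n)
  have h2 := congrArg (Polynomial.eval y) (U_add_two ℝ (n - 1))
  have h3 := congrArg (Polynomial.eval y) (U_add_two ℝ (n - 2))
  rw [show n - 1 + 2 = n + 1 by ring, show n - 1 + 1 = n by ring] at h2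
  rw [show n - 2 + 2 = n by ring, show n - 2 + 1 = n - 1 by ring] at h3
  simp only [Polynomial.eval_sub, Polynomial.eval_mul, Polynomial.eval_ofNat,
    Polynomial.eval_X] at h1 h2 h3
  linear_combination (-2 * y) * h2 - h1 - h3

/-- The `q`-binomial coefficient `[2n+1, n-k]_q`, extended by `0` to `k > n`. -/
noncomputable def shiftedQBinom (q : ℝ) (n k : ℕ) : ℝ :=
  if k ≤ n then qBinom q (2 * n + 1) (n - k) else 0

theorem shiftedQBinom_of_lt (q : ℝ) {n k : ℕ} (h : n < k) : shiftedQBinom q n k = 0 := by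
  simp [shiftedQBinom, h]

theorem shiftedQBinom_self {q : ℝ} (hq : q ∈ Ioo (-1 : ℝ) 1) (n : ℕ) :
    shiftedQBinom q n n = 1 := by
  simp [shiftedQBinom, qBinom_zero_right hq]

theorem shiftedQBinom_add (q : ℝ) (j k : ℕ) :
    shiftedQBinom q (k + j) k = qBinom q (2 * (k + j) + 1) j := by
  simp [shiftedQBinom]

/-- The case `k = 0` of the recurrence `shiftedQBinom_succ_succ`, in which the coefficient at
`k = -1` has been replaced by the one at `k = 0`, by the symmetry of the `q`-binomials. -/
theorem shiftedQBinom_succ_zero {q : ℝ} (hq : q ∈ Ioo (-1 : ℝ) 1) (n : ℕ) :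
    shiftedQBinom q (n + 1) 0 = (1 + q ^ (2 * (n + 1))) * shiftedQBinom q n 0 +
      q ^ (n + 1) * shiftedQBinom q n 0 + q ^ (n + 2) * shiftedQBinom q n 1 := by
  rcases n with _ | n
  · have h := qBinom_succ_succ hq 2 0
    have h' := qBinom_succ_succ hq 1 0
    simp only [zero_add] at h h'
    simp only [shiftedQBinom]
    simp [qBinom_zero_right hq]
    norm_num [qBinom_zero_right hq] at *
    rw [h, h', qBinom_self hq]
    ring
  · have h := qBinom_add_two hq (n + 2) n
    have h0 := shiftedQBinom_add q (n + 2) 0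
    have h1 := shiftedQBinom_add q (n + 1) 0
    have h2 := shiftedQBinom_add q n 1
    have hs := qBinom_add_comm q (n + 1) (n + 2)
    rw [show n + 1 + (n + 2) = 2 * (n + 1) + 1 by ring] at hs
    rw [show n + (n + 2) + 1 = 2 * (n + 1) + 1 by ring, ← hs,
      show n + (n + 2) + 2 = 2 * (n + 1 + 1) by ring,
      show 2 * (n + 1) + 1 + 2 = 2 * (n + 2) + 1 by ring] at h
    rw [zero_add] at h0 h1
    rw [show 1 + n = n + 1 by ring] at h2
    rw [h0, h1, h2, h]

theorem shiftedQBinom_succ_succ {q : ℝ} (hq : q ∈ Ioo (-1 : ℝ) 1) {n k : ℕ} (hk : k ≤ n) :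
    shiftedQBinom q (n + 1) (k + 1) = (1 + q ^ (2 * (n + 1))) * shiftedQBinom q n (k + 1) +
      q ^ (n - k) * shiftedQBinom q n k +
        q ^ (n + k + 3) * shiftedQBinom q n (k + 2) := by
  obtain ⟨j, rfl⟩ : ∃ j, n = k + j := ⟨n - k, by omega⟩
  rw [Nat.add_sub_cancel_left]
  rcases j with _ | _ | j
  · simp [shiftedQBinom_self hq, shiftedQBinom_of_lt]
  · have e1 := shiftedQBinom_add q 1 (k + 1)
    have e2 := shiftedQBinom_add q 0 (k + 1)
    have e3 := shiftedQBinom_add q 1 k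
    have h := qBinom_succ_succ hq (2 * (k + 1) + 1 + 1) 0
    have h' := qBinom_succ_succ' hq 0 (2 * (k + 1) + 1)
    rw [zero_add, zero_add] at *
    rw [add_zero] at e2
    rw [show k + 1 + 1 = k + 2 by ring] at *
    rw [shiftedQBinom_of_lt q (show k + 1 < k + 2 by omega), e1, e2, e3,
      show 2 * (k + 2) + 1 = 2 * (k + 1) + 1 + 1 + 1 by ring, h, h']
    simp only [qBinom_zero_right hq]
    ring
  · have e1 := shiftedQBinom_add q (j + 2) (k + 1)
    have e2 := shiftedQBinom_add q (j + 1) (k + 1)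
    have e3 := shiftedQBinom_add q (j + 2) k
    have e4 := shiftedQBinom_add q j (k + 2)
    have h := qBinom_add_two hq (2 * k + j + 4) j
    rw [show k + 1 + (j + 2) = k + j + 3 by ring] at e1
    rw [show k + 1 + (j + 1) = k + j + 2 by ring] at e2
    rw [show k + (j + 2) = k + j + 2 by ring] at e3
    rw [show k + 2 + j = k + j + 2 by ring] at e4
    rw [show j + (2 * k + j + 4) + 1 = 2 * (k + j + 2) + 1 by ring,
      show 2 * (k + j + 2) + 1 + 2 = 2 * (k + j + 3) + 1 by ring] at h
    rw [show k + (j + 1 + 1) = k + j + 2 by ring, show k + j + 2 + 1 = k + j + 3 by ring, e1, e2,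
      e3, e4, h]
    ring

/-- The finite triple product: `∏_{j=1}^n ((1+q^j)² - 4y²q^j)` expanded in the Chebyshev
polynomials `U_{2k}(y)`. The induction step multiplies by one more factor, using the three-term
recurrence for `4y²U_{2k}(y)` and the matching recurrence for `[2n+1, n-k]_q`. -/
theorem prod_eq_sum_shiftedQBinom {q : ℝ} (hq : q ∈ Ioo (-1 : ℝ) 1) (y : ℝ) (n : ℕ) :
    ∏ j ∈ Finset.range n, ((1 + q ^ (j + 1)) ^ 2 - 4 * y ^ 2 * q ^ (j + 1)) =
      ∑ k ∈ Finset.range (n + 1), (-1 : ℝ) ^ k * q ^ (Nat.choose (k + 1) 2) *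
        shiftedQBinom q n k * (Polynomial.Chebyshev.U ℝ (2 * (k : ℤ))).eval y := by
  induction n with
  | zero => simp [shiftedQBinom_self hq]
  | succ n ih =>
    rw [Finset.prod_range_succ, ih, Finset.sum_mul]
    set u : ℕ → ℝ := fun k => (Polynomial.Chebyshev.U ℝ (2 * (k : ℤ))).eval y with hu
    set a : ℕ → ℝ := fun k => (-1 : ℝ) ^ k * q ^ (Nat.choose (k + 1) 2) * shiftedQBinom q n k
      with ha
    have hu0 : u 0 = 1 := by simp [hu]
    have r0 : 4 * y ^ 2 * u 0 = u 1 + u 0 := by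
      have := four_sq_mul_chebyshevU y 0
      simp [hu] at this ⊢
      linarith
    have r1 : ∀ k, 4 * y ^ 2 * u (k + 1) = u (k + 2) + 2 * u (k + 1) + u k := by
      intro k
      have := four_sq_mul_chebyshevU y (2 * ((k : ℤ) + 1))
      rw [show 2 * ((k : ℤ) + 1) + 2 = 2 * ((k : ℤ) + 2) by ring,
        show 2 * ((k : ℤ) + 1) - 2 = 2 * (k : ℤ) by ring] at this
      simp only [hu]
      push_cast
      exact this
    have ha1 : a (n + 1) = 0 := by simp [ha, shiftedQBinom_of_lt]
    have ha2 : a (n + 2) = 0 := by simp [ha, shiftedQBinom_of_lt]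
    have b0 : shiftedQBinom q (n + 1) 0 = (1 + q ^ (2 * (n + 1))) * a 0 + q ^ (n + 1) * a 0
        - q ^ (n + 1) * a 1 := by
      rw [shiftedQBinom_succ_zero hq]
      simp only [ha]
      simp
      ring
    have b1 : ∀ k ≤ n, (-1 : ℝ) ^ (k + 1) * q ^ (Nat.choose (k + 2) 2) *
        shiftedQBinom q (n + 1) (k + 1) =
        (1 + q ^ (2 * (n + 1))) * a (k + 1) - q ^ (n + 1) * (a k + a (k + 2)) := by
      intro k hk
      rw [shiftedQBinom_succ_succ hq hk]
      simp only [ha]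
      obtain ⟨j, rfl⟩ : ∃ j, n = k + j := ⟨n - k, by omega⟩
      rw [Nat.add_sub_cancel_left]
      rw [choose_succ_two (k + 2), choose_succ_two (k + 1)]
      ring
    have lhs : ∀ k, a k * u k * ((1 + q ^ (n + 1)) ^ 2 - 4 * y ^ 2 * q ^ (n + 1)) =
        (1 + q ^ (2 * (n + 1))) * (a k * u k) + 2 * q ^ (n + 1) * (a k * u k)
          - q ^ (n + 1) * (a k * (4 * y ^ 2 * u k)) := by intro k; ring
    have rhs : ∀ k ∈ Finset.range (n + 1),
        (-1 : ℝ) ^ (k + 1) * q ^ (Nat.choose (k + 1 + 1) 2) * shiftedQBinom q (n + 1) (k + 1) *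
          u (k + 1) = (1 + q ^ (2 * (n + 1))) * (a (k + 1) * u (k + 1)) -
            q ^ (n + 1) * (a k * u (k + 1)) - q ^ (n + 1) * (a (k + 2) * u (k + 1)) := by
      intro k hk
      rw [b1 k (by simpa [Nat.lt_succ_iff] using hk)]
      ring
    rw [Finset.sum_congr rfl fun k _ => lhs k]
    rw [Finset.sum_range_succ' _ (n + 1), Finset.sum_congr rfl rhs]
    simp only [Finset.sum_add_distrib, Finset.sum_sub_distrib, ← Finset.mul_sum]
    have s1 : ∑ k ∈ Finset.range (n + 1), a k * u k =
        ∑ k ∈ Finset.range (n + 1), a (k + 1) * u (k + 1) + a 0 * u 0 := by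
      rw [← Finset.sum_range_succ' (fun k => a k * u k), Finset.sum_range_succ _ (n + 1), ha1]; ring
    have s2 : ∑ k ∈ Finset.range (n + 1), a (k + 1) * u k =
        ∑ k ∈ Finset.range (n + 1), a (k + 2) * u (k + 1) + a 1 * u 0 := by
      rw [← Finset.sum_range_succ' (fun k => a (k + 1) * u k), Finset.sum_range_succ _ (n + 1),
        ha2]
      ring
    have s3 : ∑ k ∈ Finset.range (n + 1), a k * (4 * y ^ 2 * u k) =
        ∑ k ∈ Finset.range (n + 1), a k * u (k + 1) +
          2 * ∑ k ∈ Finset.range (n + 1), a k * u k +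
          ∑ k ∈ Finset.range (n + 1), a (k + 1) * u k - a 0 * u 0 := by
      have e1 : ∑ k ∈ Finset.range (n + 1), a k * u (k + 1) =
          ∑ k ∈ Finset.range n, a (k + 1) * u (k + 2) + a 0 * u 1 := Finset.sum_range_succ' _ _
      have e2 : ∑ k ∈ Finset.range (n + 1), a k * u k =
          ∑ k ∈ Finset.range n, a (k + 1) * u (k + 1) + a 0 * u 0 := Finset.sum_range_succ' _ _
      have e3 : ∑ k ∈ Finset.range (n + 1), a (k + 1) * u k =
          ∑ k ∈ Finset.range n, a (k + 1) * u k := by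
        rw [Finset.sum_range_succ, ha1]; ring
      rw [Finset.sum_range_succ', e1, e2, e3, r0, Finset.sum_congr rfl fun k _ => by rw [r1 k]]
      simp only [mul_add, Finset.sum_add_distrib, Finset.mul_sum]
      simp only [mul_left_comm]
      ring
    rw [s3, s2]
    simp only [zero_add, pow_zero, one_mul, Nat.choose_eq_zero_of_lt (show 1 < 2 by norm_num)]
    rw [b0, s1]
    ring

/-! ### Convergence of the infinite products and series -/

theorem pow_succ_mem_Ioo {q : ℝ} (hq : q ∈ Ioo (-1 : ℝ) 1) (k : ℕ) :
    q ^ (k + 1) ∈ Ioo (-1 : ℝ) 1 := by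
  rw [mem_Ioo, ← abs_lt, abs_pow]
  exact pow_lt_one₀ (abs_nonneg q) (abs_lt.2 hq) (Nat.succ_ne_zero k)

theorem summable_pow_succ {q : ℝ} (hq : q ∈ Ioo (-1 : ℝ) 1) : Summable (fun k : ℕ => q ^ (k + 1)) :=
  (summable_nat_add_iff (f := fun k : ℕ => q ^ k) 1).2
    (summable_geometric_of_abs_lt_one (abs_lt.2 hq))

theorem summable_pow_succ_sq {q : ℝ} (hq : q ∈ Ioo (-1 : ℝ) 1) :
    Summable (fun k : ℕ => (q ^ (k + 1)) ^ 2) := by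
  simp_rw [← pow_mul, mul_comm _ 2, pow_mul]
  exact summable_pow_succ ⟨by nlinarith [sq_nonneg q], by nlinarith [hq.1, hq.2]⟩

theorem multipliable_factor {q : ℝ} (hq : q ∈ Ioo (-1 : ℝ) 1) (t : ℝ) :
    Multipliable (fun k : ℕ => (1 + q ^ (k + 1)) ^ 2 - t * q ^ (k + 1)) := by
  refine (Real.multipliable_one_add_of_summable (((summable_pow_succ hq).mul_left (2 - t)).add
    (summable_pow_succ_sq hq))).congr fun k => ?_
  ring

theorem factor_pos {q : ℝ} (hq : q ∈ Ioo (-1 : ℝ) 1) {t : ℝ} (ht : t ∈ Icc (0 : ℝ) 4) (k : ℕ) :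
    0 < (1 + q ^ (k + 1)) ^ 2 - t * q ^ (k + 1) := by
  obtain ⟨h1, h2⟩ := pow_succ_mem_Ioo hq k
  generalize q ^ (k + 1) = z at *
  obtain ⟨ht0, ht4⟩ := ht
  rcases le_total 0 z with hz | hz
  · nlinarith [mul_pos (sub_pos.2 h2) (sub_pos.2 h2), mul_nonneg (sub_nonneg.2 ht4) hz]
  · have : 0 < 1 + z := by linarith
    nlinarith [mul_pos this this, mul_nonneg ht0 (neg_nonneg.2 hz)]

theorem tprod_one_add_pos {f : ℕ → ℝ} (hf : Summable f) (hpos : ∀ k, 0 < 1 + f k) :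
    0 < ∏' k, (1 + f k) := by
  rw [← Real.rexp_tsum_eq_tprod hpos (Real.summable_log_one_add_of_summable hf)]
  exact Real.exp_pos _

theorem qPochhammerInf_self_pos {q : ℝ} (hq : q ∈ Ioo (-1 : ℝ) 1) : 0 < qPochhammerInf q q := by
  have h := tprod_one_add_pos (summable_pow_succ hq).neg
    fun k => by linarith [(pow_succ_mem_Ioo hq k).2]
  simpa only [qPochhammerInf, ← pow_succ', ← sub_eq_add_neg] using h

/-- The finite `q`-Pochhammer symbol `(q|q)_n`. -/
noncomputable def qPochhammer (q : ℝ) (n : ℕ) : ℝ := ∏ i ∈ Finset.range n, (1 - q * q ^ i)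

theorem qPochhammer_eq (q : ℝ) (n : ℕ) : qPochhammer q n = qFactorial q n * (1 - q) ^ n := by
  induction n with
  | zero => simp [qPochhammer, qFactorial_zero]
  | succ n ih =>
    rw [qPochhammer, Finset.prod_range_succ, ← qPochhammer, ih, qFactorial_succ, ← pow_succ',
      ← qNumber_mul_one_sub]
    ring

theorem qPochhammer_pos {q : ℝ} (hq : q ∈ Ioo (-1 : ℝ) 1) (n : ℕ) : 0 < qPochhammer q n := by
  rw [qPochhammer_eq]
  have := hq.2
  exact mul_pos (qFactorial_pos hq n) (pow_pos (by linarith) n)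

theorem qBinom_add_eq_qPochhammer {q : ℝ} (hq : q ∈ Ioo (-1 : ℝ) 1) (a b : ℕ) :
    qBinom q (a + b) a = qPochhammer q (a + b) / (qPochhammer q a * qPochhammer q b) := by
  have h1 := (qFactorial_pos hq a).ne'
  have h2 := (qFactorial_pos hq b).ne'
  have h3 : (1 - q) ≠ 0 := by linarith [hq.2]
  rw [qBinom_add, qPochhammer_eq, qPochhammer_eq, qPochhammer_eq,
    pow_add]
  field_simp

theorem tendsto_qPochhammer {q : ℝ} (hq : q ∈ Ioo (-1 : ℝ) 1) :
    Tendsto (qPochhammer q) atTop (𝓝 (qPochhammerInf q q)) :=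
  (multipliable_qPochhammerInf q q hq).tendsto_prod_tprod_nat

theorem exists_abs_qBinom_le {q : ℝ} (hq : q ∈ Ioo (-1 : ℝ) 1) :
    ∃ C, 0 ≤ C ∧ ∀ a b, |qBinom q (a + b) a| ≤ C := by
  obtain ⟨M, hM⟩ := (tendsto_qPochhammer hq).bddAbove_range
  obtain ⟨K, hK⟩ := ((tendsto_qPochhammer hq).inv₀ (qPochhammerInf_self_pos hq).ne').bddAbove_range
  have hM' : ∀ n, qPochhammer q n ≤ M := fun n => hM ⟨n, rfl⟩
  have hK' : ∀ n, (qPochhammer q n)⁻¹ ≤ K := fun n => hK ⟨n, rfl⟩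
  have hp := qPochhammer_pos hq
  have hM0 : 0 ≤ M := (hp 0).le.trans (hM' 0)
  have hK0 : 0 ≤ K := (inv_pos.2 (hp 0)).le.trans (hK' 0)
  refine ⟨M * (K * K), by positivity, fun a b => ?_⟩
  have h1 := hp a
  have h2 := hp b
  have h3 := hp (a + b)
  rw [qBinom_add_eq_qPochhammer hq, abs_of_pos (by positivity), div_eq_mul_inv, mul_inv]
  gcongr
  exacts [hM' _, hK' _, hK' _]

theorem shiftedQBinom_eq {q : ℝ} {n k : ℕ} (h : k ≤ n) :
    shiftedQBinom q n k = qBinom q ((n - k) + (n + k + 1)) (n - k) := by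
  rw [shiftedQBinom, if_pos h]
  congr 1
  omega

theorem tendsto_shiftedQBinom {q : ℝ} (hq : q ∈ Ioo (-1 : ℝ) 1) (k : ℕ) :
    Tendsto (fun n => shiftedQBinom q n k) atTop (𝓝 (qPochhammerInf q q)⁻¹) := by
  have hP := tendsto_qPochhammer hq
  have h0 := (qPochhammerInf_self_pos hq).ne'
  have t1 : Tendsto (fun n : ℕ => n - k) atTop atTop := tendsto_sub_atTop_nat k
  have t2 : Tendsto (fun n : ℕ => n + k + 1) atTop atTop := by
    simpa only [add_assoc] using tendsto_add_atTop_nat (k + 1)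
  have := (hP.comp (t1.atTop_add_atTop t2)).div ((hP.comp t1).mul (hP.comp t2)) (mul_ne_zero h0 h0)
  rw [div_mul_cancel_left₀ h0] at this
  refine this.congr' ?_
  filter_upwards [eventually_ge_atTop k] with n hn
  rw [shiftedQBinom_eq hn, qBinom_add_eq_qPochhammer hq]
  rfl

/-- Induction with `U_{n+1} = y U_n + T_{n+1}` and `|T_{n+1}| ≤ 1`. -/
theorem abs_chebyshevU_le {y : ℝ} (hy : |y| ≤ 1) (n : ℕ) :
    |(Polynomial.Chebyshev.U ℝ n).eval y| ≤ n + 1 := by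
  induction n with
  | zero => simp
  | succ n ih =>
    have h := congrArg (Polynomial.eval y) (Polynomial.Chebyshev.U_eq_X_mul_U_add_T ℝ (n : ℤ))
    rw [Polynomial.eval_add, Polynomial.eval_mul, Polynomial.eval_X] at h
    push_cast
    rw [h]
    have hT := Polynomial.Chebyshev.abs_eval_T_real_le_one ((n : ℤ) + 1) hy
    have h2 : |y| * |(Polynomial.Chebyshev.U ℝ n).eval y| ≤ 1 * (n + 1) :=
      mul_le_mul hy ih (abs_nonneg _) zero_le_one
    refine (abs_add_le _ _).trans ?_
    rw [abs_mul]
    linarith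

theorem abs_pow_choose_le {q : ℝ} (hq : q ∈ Ioo (-1 : ℝ) 1) (k : ℕ) :
    |q ^ (Nat.choose (k + 1) 2)| ≤ |q| ^ k := by
  rw [abs_pow]
  refine pow_le_pow_of_le_one (abs_nonneg q) (abs_lt.2 hq).le ?_
  rw [choose_succ_two]
  omega

theorem summable_linear_sq_mul_geometric {r : ℝ} (hr0 : 0 ≤ r) (hr : r < 1) :
    Summable (fun k : ℕ => (2 * (k : ℝ) + 1) ^ 2 * r ^ k) := by
  have h (m : ℕ) := summable_pow_mul_geometric_of_norm_lt_one m
    (show ‖r‖ < 1 by rwa [Real.norm_of_nonneg hr0])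
  refine ((((h 2).mul_left 4).add ((h 1).mul_left 4)).add (h 0)).congr fun k => ?_
  ring

/-- Every series with these terms converges absolutely, as its exponents are at least `k`. -/
theorem summable_mul_pow_choose {q : ℝ} (hq : q ∈ Ioo (-1 : ℝ) 1) {c : ℕ → ℝ}
    (hc : ∀ k, |c k| ≤ (2 * (k : ℝ) + 1) ^ 2) :
    Summable (fun k : ℕ => c k * q ^ (Nat.choose (k + 1) 2)) := by
  refine Summable.of_norm_bounded
    (summable_linear_sq_mul_geometric (abs_nonneg q) (abs_lt.2 hq)) fun k => ?_
  rw [Real.norm_eq_abs, abs_mul]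
  exact mul_le_mul (hc k) (abs_pow_choose_le hq k) (abs_nonneg _) (by positivity)

/-! ### The triple product identity -/

theorem abs_chebyshevU_two_mul_le {y : ℝ} (hy : |y| ≤ 1) (k : ℕ) :
    |(Polynomial.Chebyshev.U ℝ (2 * (k : ℤ))).eval y| ≤ 2 * (k : ℝ) + 1 := by
  have := abs_chebyshevU_le hy (2 * k)
  push_cast at this
  exact this

theorem le_two_mul_add_one_sq (k : ℕ) : 2 * (k : ℝ) + 1 ≤ (2 * (k : ℝ) + 1) ^ 2 := by
  have : (0 : ℝ) ≤ k := k.cast_nonneg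
  nlinarith

theorem summable_tripleProduct {q : ℝ} (hq : q ∈ Ioo (-1 : ℝ) 1) {y : ℝ} (hy : |y| ≤ 1) :
    Summable (fun k : ℕ => (-1 : ℝ) ^ k * q ^ (Nat.choose (k + 1) 2) *
      (Polynomial.Chebyshev.U ℝ (2 * (k : ℤ))).eval y) := by
  refine (summable_mul_pow_choose hq (c := fun k => (-1 : ℝ) ^ k *
    (Polynomial.Chebyshev.U ℝ (2 * (k : ℤ))).eval y) fun k => ?_).congr fun k => by ring
  rw [abs_mul, abs_neg_one_pow, one_mul]
  exact (abs_chebyshevU_two_mul_le hy k).trans (le_two_mul_add_one_sq k)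

/-- The triple product identity in Chebyshev form, as the limit of the finite one: for fixed `k`
the coefficient `[2n+1, n-k]_q` tends to `1/(q)_∞`, and these coefficients are bounded. -/
theorem tripleProduct {q : ℝ} (hq : q ∈ Ioo (-1 : ℝ) 1) {y : ℝ} (hy : |y| ≤ 1) :
    qPochhammerInf q q * ∏' k : ℕ, ((1 + q ^ (k + 1)) ^ 2 - 4 * y ^ 2 * q ^ (k + 1)) =
      ∑' k : ℕ, (-1 : ℝ) ^ k * q ^ (Nat.choose (k + 1) 2) *
        (Polynomial.Chebyshev.U ℝ (2 * (k : ℤ))).eval y := by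
  obtain ⟨C, hC0, hC⟩ := exists_abs_qBinom_le hq
  set s : ℕ → ℝ := fun k => (-1 : ℝ) ^ k * q ^ (Nat.choose (k + 1) 2) *
        (Polynomial.Chebyshev.U ℝ (2 * (k : ℤ))).eval y with hs
  have hlim : Tendsto (fun n => ∑' k, s k * shiftedQBinom q n k) atTop
      (𝓝 (∑' k, s k * (qPochhammerInf q q)⁻¹)) := by
    refine tendsto_tsum_of_dominated_convergence (bound := fun k => |s k| * C)
      ((summable_tripleProduct hq hy).abs.mul_right C)
      (fun k => (tendsto_shiftedQBinom hq k).const_mul _) (Eventually.of_forall fun n k => ?_)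
    rw [Real.norm_eq_abs, abs_mul]
    refine mul_le_mul_of_nonneg_left ?_ (abs_nonneg _)
    rcases le_or_gt k n with h | h
    · rw [shiftedQBinom_eq h]
      exact hC _ _
    · rw [shiftedQBinom_of_lt q h, abs_zero]
      exact hC0
  have hprod := (multipliable_factor hq (4 * y ^ 2)).tendsto_prod_tprod_nat
  have heq : ∀ n, ∏ j ∈ Finset.range n, ((1 + q ^ (j + 1)) ^ 2 - 4 * y ^ 2 * q ^ (j + 1)) =
      ∑' k, s k * shiftedQBinom q n k := by
    intro n
    rw [prod_eq_sum_shiftedQBinom hq, tsum_eq_sum (s := Finset.range (n + 1))]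
    · exact Finset.sum_congr rfl fun k _ => by simp only [hs]; ring
    · intro k hk
      rw [shiftedQBinom_of_lt q (by simpa using hk), mul_zero]
  simp only [heq] at hprod
  rw [tendsto_nhds_unique hprod hlim, tsum_mul_right]
  have := (qPochhammerInf_self_pos hq).ne'
  field_simp

/-! ### Three specializations -/

/-- At `y = 0` the values `U_{2k}` are `(-1)^k`, which cancels the signs of the series. -/
theorem gauss_triangular_series {q : ℝ} (hq : q ∈ Ioo (-1 : ℝ) 1) :
    Summable (fun k : ℕ => q ^ (Nat.choose (k + 1) 2)) ∧
      qPochhammerInf (-q) q * qPochhammerInf (q ^ 2) (q ^ 2) =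
        ∑' k : ℕ, q ^ (Nat.choose (k + 1) 2) := by
  have hq2 : q ^ 2 ∈ Ioo (-1 : ℝ) 1 := pow_succ_mem_Ioo hq 1
  have hsum := summable_tripleProduct hq (y := 0) (by simp)
  have h := tripleProduct hq (y := 0) (by simp)
  have e : ∀ k : ℕ, (-1 : ℝ) ^ k * q ^ (Nat.choose (k + 1) 2) *
      (Polynomial.Chebyshev.U ℝ (2 * (k : ℤ))).eval 0 = q ^ (Nat.choose (k + 1) 2) := by
    intro k
    rw [Polynomial.Chebyshev.U_eval_two_mul_zero, Int.negOnePow_def]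
    have : ((-1 : ℝ) ^ k) * (-1) ^ k = 1 := by rw [← mul_pow]; simp
    simp only [zpow_natCast, Units.val_pow_eq_pow_val, Units.val_neg, Units.val_one,
      Int.cast_pow, Int.cast_neg, Int.cast_one]
    linear_combination q ^ (Nat.choose (k + 1) 2) * this
  simp only [e] at hsum h
  refine ⟨hsum, h ▸ ?_⟩
  have m1 := multipliable_qPochhammerInf q q hq
  have m2 := multipliable_qPochhammerInf (-q) q hq
  have m3 := multipliable_qPochhammerInf (q ^ 2) (q ^ 2) hq2
  have m4 := multipliable_factor hq (4 * (0 : ℝ) ^ 2)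
  unfold qPochhammerInf
  rw [← m2.tprod_mul m3, ← m1.tprod_mul m4]
  exact tprod_congr fun k => by ring

/-- At `y = 1` the values `U_{2k}` are `2k+1`, and the product is `∏ (1 - q^k)²`. -/
theorem jacobi_cube_series {q : ℝ} (hq : q ∈ Ioo (-1 : ℝ) 1) :
    Summable (fun k : ℕ => (-1 : ℝ) ^ ((k + 2) + 1) * (2 * ((k : ℝ) + 2) - 1) *
        q ^ (Nat.choose (k + 2) 2)) ∧
      qPochhammerInf q q ^ 3 =
        1 + ∑' k : ℕ, (-1 : ℝ) ^ ((k + 2) + 1) * (2 * ((k : ℝ) + 2) - 1) *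
          q ^ (Nat.choose (k + 2) 2) := by
  have hsum := summable_tripleProduct hq (y := 1) (by simp)
  have h := tripleProduct hq (y := 1) (by simp)
  rw [hsum.tsum_eq_zero_add] at h
  have hsum' := (summable_nat_add_iff 1).2 hsum
  have e : ∀ k : ℕ, (-1 : ℝ) ^ (k + 1) * q ^ (Nat.choose (k + 1 + 1) 2) *
      (Polynomial.Chebyshev.U ℝ (2 * ((k + 1 : ℕ) : ℤ))).eval 1 =
        (-1 : ℝ) ^ ((k + 2) + 1) * (2 * ((k : ℝ) + 2) - 1) * q ^ (Nat.choose (k + 2) 2) := by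
    intro k
    rw [Polynomial.Chebyshev.U_eval_one]
    push_cast
    ring
  simp only [e] at hsum' h
  refine ⟨hsum', ?_⟩
  simp only [CharP.cast_eq_zero, mul_zero, Polynomial.Chebyshev.U_zero, Polynomial.eval_one,
    zero_add, pow_zero, mul_one, Nat.choose_eq_zero_of_lt (show 1 < 2 by norm_num)] at h
  rw [← h]
  have m1 := multipliable_qPochhammerInf q q hq
  have m4 := multipliable_factor hq (4 * (1 : ℝ) ^ 2)
  unfold qPochhammerInf
  rw [pow_three, ← m1.tprod_mul m1, ← m1.tprod_mul (m1.mul m1), ← m1.tprod_mul m4]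
  exact tprod_congr fun k => by ring

theorem chebyshevU_add_three_half (n : ℤ) :
    (Polynomial.Chebyshev.U ℝ (n + 3)).eval (1 / 2) =
      -(Polynomial.Chebyshev.U ℝ n).eval (1 / 2) := by
  have h1 := congrArg (Polynomial.eval (1 / 2)) (Polynomial.Chebyshev.U_add_two ℝ n)
  have h2 := congrArg (Polynomial.eval (1 / 2)) (Polynomial.Chebyshev.U_add_two ℝ (n + 1))
  rw [show n + 1 + 2 = n + 3 by ring, show n + 1 + 1 = n + 2 by ring] at h2
  simp only [Polynomial.eval_sub, Polynomial.eval_mul, Polynomial.eval_ofNat,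
    Polynomial.eval_X] at h1 h2
  linear_combination h2 + h1

theorem chebyshevU_six_mul_add_half (m : ℕ) (n : ℤ) :
    (Polynomial.Chebyshev.U ℝ (6 * m + n)).eval (1 / 2) =
      (Polynomial.Chebyshev.U ℝ n).eval (1 / 2) := by
  induction m with
  | zero => simp
  | succ m ih =>
    rw [← ih, show 6 * ((m + 1 : ℕ) : ℤ) + n = (6 * m + n + 3) + 3 by push_cast; ring,
      chebyshevU_add_three_half, chebyshevU_add_three_half, neg_neg]

/-- At `y = 1/2` the values `U_{2k}` are `1, 0, -1` with period three in `k`, and the product is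
`∏ (1 + q^k + q^(2k))`. -/
theorem euler_series_cube_base {q : ℝ} (hq : q ∈ Ioo (-1 : ℝ) 1) :
    Summable (fun k : ℕ => (-1 : ℝ) ^ (3 * (k + 1)) *
        (q ^ (Nat.choose (3 * (k + 1)) 2) + q ^ (Nat.choose (3 * (k + 1) + 1) 2))) ∧
      qPochhammerInf (q ^ 3) (q ^ 3) =
        1 + ∑' k : ℕ, (-1 : ℝ) ^ (3 * (k + 1)) *
          (q ^ (Nat.choose (3 * (k + 1)) 2) + q ^ (Nat.choose (3 * (k + 1) + 1) 2)) := by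
  have hy : |(1 / 2 : ℝ)| ≤ 1 := by norm_num [abs_le]
  have hsum := summable_tripleProduct hq hy
  have h := tripleProduct hq hy
  set s : ℕ → ℝ := fun k => (-1 : ℝ) ^ k * q ^ (Nat.choose (k + 1) 2) *
    (Polynomial.Chebyshev.U ℝ (2 * (k : ℤ))).eval (1 / 2) with hs
  have U4 : (Polynomial.Chebyshev.U ℝ 4).eval (1 / 2) = -1 := by
    have := chebyshevU_add_three_half 1
    norm_num at this ⊢
    exact this
  have e0 : ∀ m : ℕ, s (0 + 3 * m) = (-1 : ℝ) ^ (3 * m) * q ^ (Nat.choose (3 * m + 1) 2) := by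
    intro m
    have := chebyshevU_six_mul_add_half m 0
    simp only [hs, zero_add]
    rw [show 2 * ((3 * m : ℕ) : ℤ) = 6 * m + 0 by push_cast; ring, this]
    simp
  have e1 : ∀ m : ℕ, s (1 + 3 * m) = 0 := by
    intro m
    have := chebyshevU_six_mul_add_half m 2
    simp only [hs]
    rw [show 2 * ((1 + 3 * m : ℕ) : ℤ) = 6 * m + 2 by push_cast; ring, this,
      Polynomial.Chebyshev.U_two]
    norm_num
  have e2 : ∀ m : ℕ, s (2 + 3 * m) =
      (-1 : ℝ) ^ (3 * (m + 1)) * q ^ (Nat.choose (3 * (m + 1)) 2) := by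
    intro m
    have := chebyshevU_six_mul_add_half m 4
    simp only [hs]
    rw [show 2 * ((2 + 3 * m : ℕ) : ℤ) = 6 * m + 4 by push_cast; ring, this, U4,
      show 2 + 3 * m + 1 = 3 * (m + 1) by ring, show 3 * (m + 1) = (2 + 3 * m) + 1 by ring,
      pow_succ]
    ring
  have i0 : Summable (fun m : ℕ => s (0 + 3 * m)) :=
    hsum.comp_injective fun a b hab => by simpa using hab
  have i2 : Summable (fun m : ℕ => s (2 + 3 * m)) :=
    hsum.comp_injective fun a b hab => by simpa using hab
  have t : ∑' n, s n = ∑' m, s (0 + 3 * m) + ∑' m, s (1 + 3 * m) + ∑' m, s (2 + 3 * m) :=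
    (Nat.sumByResidueClasses hsum 3).trans
      (Fin.sum_univ_three fun j : Fin 3 => ∑' m, s (j.val + 3 * m))
  rw [i0.tsum_eq_zero_add] at t
  have i0' := (summable_nat_add_iff 1).2 i0
  simp only [e0, e1, e2, tsum_zero, add_zero] at t i0' i2
  have hadd := i2.add i0'
  simp only [← mul_add] at hadd
  refine ⟨hadd, ?_⟩
  have ht := i2.tsum_add i0'
  simp only [← mul_add] at ht
  rw [ht]
  have hq3 : q ^ 3 ∈ Ioo (-1 : ℝ) 1 := pow_succ_mem_Ioo hq 2
  have hp : qPochhammerInf (q ^ 3) (q ^ 3) = ∑' k, s k := by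
    rw [← h]
    unfold qPochhammerInf
    rw [← (multipliable_qPochhammerInf q q hq).tprod_mul (multipliable_factor hq _)]
    exact tprod_congr fun k => by ring
  rw [hp, t]
  simp
  ring

/-! ### The density as a theta series -/

/-- The theta series `∑_{k≥0} q^(k(k+1)/2) cos((2k+1)φ)`. -/
noncomputable def thetaSeries (q φ : ℝ) : ℝ :=
  ∑' k : ℕ, q ^ (Nat.choose (k + 1) 2) * Real.cos ((2 * k + 1) * φ)

/-- The density, up to a constant factor, as a function of `t = (1-q)x² ∈ [0, 4]`. -/
noncomputable def profile (q t : ℝ) : ℝ :=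
  √(4 - t) * ∏' k : ℕ, ((1 + q ^ (k + 1)) ^ 2 - t * q ^ (k + 1))

theorem density_eq_profile {q x : ℝ} (hq : q ∈ Ioo (-1 : ℝ) 1)
    (hx : x ∈ Icc (-(2 / √(1 - q))) (2 / √(1 - q))) :
    density q x =
      √(1 - q) / (2 * Real.pi) * qPochhammerInf q q * profile q ((1 - q) * x ^ 2) := by
  have hp : ∏' k : ℕ, ((1 + q ^ k) ^ 2 - (1 - q) * x ^ 2 * q ^ k) =
      (4 - (1 - q) * x ^ 2) *
        ∏' k : ℕ, ((1 + q ^ (k + 1)) ^ 2 - (1 - q) * x ^ 2 * q ^ (k + 1)) := by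
    refine HasProd.tprod_eq ?_
    have h := (multipliable_factor hq ((1 - q) * x ^ 2)).hasProd
    have := HasProd.zero_mul (f := fun k : ℕ => (1 + q ^ k) ^ 2 - (1 - q) * x ^ 2 * q ^ k) h
    norm_num at this
    exact this
  have hs : (4 - (1 - q) * x ^ 2) / √(4 - (1 - q) * x ^ 2) = √(4 - (1 - q) * x ^ 2) :=
    Real.div_sqrt
  unfold density profile qPochhammerInf
  rw [if_pos (abs_le.2 hx), hp]
  simp only [← pow_succ']
  generalize ∏' k : ℕ, ((1 + q ^ (k + 1)) ^ 2 - (1 - q) * x ^ 2 * q ^ (k + 1)) = P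
  generalize ∏' k : ℕ, (1 - q ^ (k + 1)) = Q
  linear_combination √(1 - q) / (2 * Real.pi) * P * Q * hs

/-- The triple product identity at `y = sin φ`. -/
theorem profile_four_mul_sin_sq {q φ : ℝ} (hq : q ∈ Ioo (-1 : ℝ) 1)
    (hφ : φ ∈ Icc (-(Real.pi / 2)) (Real.pi / 2)) :
    profile q (4 * Real.sin φ ^ 2) = 2 / qPochhammerInf q q * thetaSeries q φ := by
  have hc : 0 ≤ Real.cos φ := Real.cos_nonneg_of_mem_Icc hφ
  have hsq : √(4 - 4 * Real.sin φ ^ 2) = 2 * Real.cos φ := by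
    rw [show 4 - 4 * Real.sin φ ^ 2 = (2 * Real.cos φ) ^ 2 by
      rw [Real.sin_sq]; ring, Real.sqrt_sq (by linarith)]
  have h := tripleProduct hq (Real.abs_sin_le_one φ)
  have hU : ∀ k : ℕ, (-1 : ℝ) ^ k * q ^ (Nat.choose (k + 1) 2) *
      (Polynomial.Chebyshev.U ℝ (2 * (k : ℤ))).eval (Real.sin φ) * Real.cos φ =
        q ^ (Nat.choose (k + 1) 2) * Real.cos ((2 * k + 1) * φ) := by
    intro k
    have h1 := Polynomial.Chebyshev.U_real_cos (Real.pi / 2 - φ) (2 * (k : ℤ))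
    rw [Real.cos_pi_div_two_sub, Real.sin_pi_div_two_sub] at h1
    push_cast at h1
    rw [show (2 * (k : ℝ) + 1) * (Real.pi / 2 - φ) =
      (Real.pi / 2 - (2 * k + 1) * φ) + k * Real.pi by ring, Real.sin_add_nat_mul_pi,
      Real.sin_pi_div_two_sub] at h1
    have h2 : ((-1 : ℝ) ^ k) * (-1) ^ k = 1 := by rw [← mul_pow]; simp
    rw [mul_assoc, h1]
    linear_combination q ^ (Nat.choose (k + 1) 2) * Real.cos ((2 * k + 1) * φ) * h2
  have h3 : thetaSeries q φ = qPochhammerInf q q *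
      (∏' k : ℕ, ((1 + q ^ (k + 1)) ^ 2 - 4 * Real.sin φ ^ 2 * q ^ (k + 1))) * Real.cos φ := by
    rw [h, ← tsum_mul_right]
    exact tsum_congr fun k => (hU k).symm
  have := (qPochhammerInf_self_pos hq).ne'
  rw [h3, profile, hsq]
  generalize ∏' k : ℕ, ((1 + q ^ (k + 1)) ^ 2 - 4 * Real.sin φ ^ 2 * q ^ (k + 1)) = P
  field_simp

theorem summable_abs_pow_choose {q : ℝ} (hq : q ∈ Ioo (-1 : ℝ) 1) :
    Summable (fun k : ℕ => |q ^ (Nat.choose (k + 1) 2)|) :=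
  (gauss_triangular_series hq).1.abs

theorem continuous_thetaSeries {q : ℝ} (hq : q ∈ Ioo (-1 : ℝ) 1) :
    Continuous (thetaSeries q) := by
  refine continuous_tsum (fun k => by fun_prop) (summable_abs_pow_choose hq) fun k φ => ?_
  rw [Real.norm_eq_abs, abs_mul]
  exact mul_le_of_le_one_right (abs_nonneg _) (Real.abs_cos_le_one _)

/-- Up to the end point `4` the continuity comes from the theta series, by `t = 4 sin²φ`. -/
theorem continuousOn_profile {q : ℝ} (hq : q ∈ Ioo (-1 : ℝ) 1) :
    ContinuousOn (profile q) (Icc 0 4) := by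
  have hcont : Continuous fun t : ℝ =>
      2 / qPochhammerInf q q * thetaSeries q (Real.arcsin (√t / 2)) :=
    continuous_const.mul ((continuous_thetaSeries hq).comp
      (Real.continuous_arcsin.comp (Real.continuous_sqrt.div_const 2)))
  refine hcont.continuousOn.congr fun t ht => ?_
  have hs : √t ≤ 2 := (Real.sqrt_le_left (by norm_num)).2 (by linarith [ht.2])
  beta_reduce
  rw [← profile_four_mul_sin_sq hq (Real.arcsin_mem_Icc _),
    Real.sin_arcsin (by linarith [Real.sqrt_nonneg t]) (by linarith), div_pow, Real.sq_sqrt ht.1]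
  congr 1
  ring

/-! ### Strict log-concavity of the profile -/

/-- The logarithm of the profile, as a sum over the factors of the product. -/
noncomputable def logProfile (q t : ℝ) : ℝ :=
  1 / 2 * Real.log (4 - t) + ∑' k : ℕ, Real.log ((1 + q ^ (k + 1)) ^ 2 - t * q ^ (k + 1))

theorem summable_log_factor {q : ℝ} (hq : q ∈ Ioo (-1 : ℝ) 1) (t : ℝ) :
    Summable (fun k : ℕ => Real.log ((1 + q ^ (k + 1)) ^ 2 - t * q ^ (k + 1))) := by
  refine (Real.summable_log_one_add_of_summable (((summable_pow_succ hq).mul_left (2 - t)).add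
    (summable_pow_succ_sq hq))).congr fun k => ?_
  congr 1
  ring

theorem exp_logProfile {q t : ℝ} (hq : q ∈ Ioo (-1 : ℝ) 1) (ht : t ∈ Ico (0 : ℝ) 4) :
    Real.exp (logProfile q t) = profile q t := by
  have h4 : 0 < 4 - t := by linarith [ht.2]
  rw [logProfile, Real.exp_add, profile,
    Real.rexp_tsum_eq_tprod (factor_pos hq ⟨ht.1, ht.2.le⟩) (summable_log_factor hq t),
    Real.sqrt_eq_rpow, Real.rpow_def_of_pos h4, mul_comm (1 / 2 : ℝ)]

theorem strictConcaveOn_logProfile {q : ℝ} (hq : q ∈ Ioo (-1 : ℝ) 1) :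
    StrictConcaveOn ℝ (Ico 0 4) (logProfile q) := by
  refine ⟨convex_Ico 0 4, fun x hx y hy hxy a b ha hb hab => ?_⟩
  have h1 := strictConcaveOn_log_Ioi.2 (show 4 - x ∈ Ioi (0 : ℝ) by simpa using hx.2)
    (show 4 - y ∈ Ioi (0 : ℝ) by simpa using hy.2) (by simpa using hxy) ha hb hab
  have h2 : ∀ k : ℕ, a * Real.log ((1 + q ^ (k + 1)) ^ 2 - x * q ^ (k + 1)) +
      b * Real.log ((1 + q ^ (k + 1)) ^ 2 - y * q ^ (k + 1)) ≤
        Real.log ((1 + q ^ (k + 1)) ^ 2 - (a * x + b * y) * q ^ (k + 1)) := by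
    intro k
    have := strictConcaveOn_log_Ioi.concaveOn.2
      (show _ ∈ Ioi (0 : ℝ) from factor_pos hq ⟨hx.1, hx.2.le⟩ k)
      (show _ ∈ Ioi (0 : ℝ) from factor_pos hq ⟨hy.1, hy.2.le⟩ k) ha.le hb.le hab
    simp only [smul_eq_mul] at this
    refine this.trans_eq (congrArg Real.log ?_)
    linear_combination (1 + q ^ (k + 1)) ^ 2 * hab
  have sx := (summable_log_factor hq x).mul_left a
  have sy := (summable_log_factor hq y).mul_left b
  have h3 := (sx.add sy).tsum_le_tsum h2 (summable_log_factor hq _)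
  rw [sx.tsum_add sy, tsum_mul_left, tsum_mul_left] at h3
  simp only [smul_eq_mul] at h1 ⊢
  rw [show a * (4 - x) + b * (4 - y) = 4 - (a * x + b * y) by linear_combination 4 * hab] at h1
  unfold logProfile
  linarith

theorem profile_four (q : ℝ) : profile q 4 = 0 := by simp [profile]

theorem profile_pos {q t : ℝ} (hq : q ∈ Ioo (-1 : ℝ) 1) (ht : t ∈ Ico (0 : ℝ) 4) :
    0 < profile q t := by
  rw [← exp_logProfile hq ht]
  exact Real.exp_pos _

/-- If the profile exceeds its value at `0` somewhere, then it increases up to an interior point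
and decreases from there on: a maximum exists by compactness, and strict log-concavity gives
strict monotonicity on either side of it. -/
theorem exists_profile_unimodal {q : ℝ} (hq : q ∈ Ioo (-1 : ℝ) 1)
    (h : ∃ t ∈ Ico (0 : ℝ) 4, profile q 0 < profile q t) :
    ∃ τ ∈ Ioo (0 : ℝ) 4, StrictMonoOn (profile q) (Icc 0 τ) ∧
      StrictAntiOn (profile q) (Icc τ 4) := by
  obtain ⟨t, ht, h0t⟩ := h
  obtain ⟨τ, hτ, hmax⟩ := isCompact_Icc.exists_isMaxOn (nonempty_Icc.2 (by norm_num))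
    (continuousOn_profile hq)
  have hmax' : ∀ s ∈ Icc (0 : ℝ) 4, profile q s ≤ profile q τ := fun s hs => hmax hs
  have hτt := hmax' t ⟨ht.1, ht.2.le⟩
  have hτ0 : 0 < τ := by
    refine lt_of_le_of_ne hτ.1 fun h => ?_
    rw [← h] at hτt
    linarith
  have hτ4 : τ < 4 := by
    refine lt_of_le_of_ne hτ.2 fun h => ?_
    rw [h, profile_four] at hτt
    linarith [profile_pos hq ht]
  have hlog : ∀ s ∈ Ico (0 : ℝ) 4, ∀ s' ∈ Ico (0 : ℝ) 4,
      (logProfile q s < logProfile q s' ↔ profile q s < profile q s') := by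
    intro s hs s' hs'
    rw [← exp_logProfile hq hs, ← exp_logProfile hq hs', Real.exp_lt_exp]
  have key : ∀ s ∈ Ico (0 : ℝ) 4, ∀ u ∈ openSegment ℝ s τ, s ≠ τ →
      profile q s < profile q u := by
    intro s hs u hu hne
    have hu4 : u ∈ Ico (0 : ℝ) 4 := (convex_Ico 0 4).openSegment_subset hs ⟨hτ.1, hτ4⟩ hu
    have hmin := (strictConcaveOn_logProfile hq).lt_on_openSegment hs ⟨hτ.1, hτ4⟩ hne hu
    have hle : logProfile q s ≤ logProfile q τ := by
      by_contra! hlt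
      exact absurd ((hlog τ ⟨hτ.1, hτ4⟩ s hs).1 hlt) (not_lt.2 (hmax' s ⟨hs.1, hs.2.le⟩))
    rw [min_eq_left hle] at hmin
    exact (hlog s hs u hu4).1 hmin
  have key' : ∀ s ∈ Ico (0 : ℝ) 4, s ≠ τ → profile q s < profile q τ := by
    intro s hs hne
    have hmem : (1 / 2 : ℝ) * s + (1 / 2) * τ ∈ openSegment ℝ s τ :=
      ⟨1 / 2, 1 / 2, by norm_num, by norm_num, by norm_num, by simp⟩
    have hu4 := (convex_Ico (0 : ℝ) 4).openSegment_subset hs ⟨hτ.1, hτ4⟩ hmem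
    exact (key s hs _ hmem hne).trans_le (hmax' _ ⟨hu4.1, hu4.2.le⟩)
  refine ⟨τ, ⟨hτ0, hτ4⟩, ?_, ?_⟩
  · intro s hs u hu hsu
    have hs4 : s ∈ Ico (0 : ℝ) 4 := ⟨hs.1, by linarith [hs.2]⟩
    rcases hu.2.eq_or_lt with rfl | hlt
    · exact key' s hs4 hsu.ne
    · refine key s hs4 u ?_ (by linarith)
      rw [openSegment_eq_Ioo (by linarith)]
      exact ⟨hsu, hlt⟩
  · intro u hu s hs hus
    rcases hs.2.eq_or_lt with rfl | hs4
    · rw [profile_four]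
      exact profile_pos hq ⟨by linarith [hu.1], hus⟩
    · have hs4' : s ∈ Ico (0 : ℝ) 4 := ⟨by linarith [hs.1], hs4⟩
      rcases hu.1.eq_or_lt with rfl | hlt
      · exact key' s hs4' hus.ne'
      · refine key s hs4' u ?_ (by linarith)
        rw [openSegment_symm, openSegment_eq_Ioo (by linarith)]
        exact ⟨hlt, hus⟩

/-- A unimodal profile, with its maximum at `τ`, makes the density bimodal, with the modes at
`±√(τ/(1-q))` and the local minimum at `0`. -/
theorem isBimodalOn_density {q : ℝ} (hq : q ∈ Ioo (-1 : ℝ) 1)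
    (h : ∃ t ∈ Ico (0 : ℝ) 4, profile q 0 < profile q t) :
    IsBimodalOn (density q) (Icc (-(2 / √(1 - q))) (2 / √(1 - q))) := by
  obtain ⟨τ, ⟨hτ0, hτ4⟩, hmono, hanti⟩ := exists_profile_unimodal hq h
  have h1 : 0 < 1 - q := by linarith [hq.2]
  have hC : 0 < √(1 - q) / (2 * Real.pi) * qPochhammerInf q q := by
    have := qPochhammerInf_self_pos hq
    have := Real.pi_pos
    have := Real.sqrt_pos.2 h1
    positivity
  set R := 2 / √(1 - q) with hR
  set m := √(τ / (1 - q)) with hm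
  have hR0 : 0 < R := by have := Real.sqrt_pos.2 h1; positivity
  have hm0 : 0 < m := Real.sqrt_pos.2 (by positivity)
  have hm2 : (1 - q) * m ^ 2 = τ := by rw [hm, Real.sq_sqrt (by positivity)]; field_simp
  have hR2 : (1 - q) * R ^ 2 = 4 := by
    rw [hR, div_pow, Real.sq_sqrt h1.le]; field_simp; norm_num
  have hmR : m < R := by
    refine lt_of_pow_lt_pow_left₀ 2 hR0.le (lt_of_mul_lt_mul_left ?_ h1.le)
    rw [hm2, hR2]
    exact hτ4
  have hlt : ∀ x ∈ Icc (-R) R, ∀ y ∈ Icc (-R) R,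
      profile q ((1 - q) * x ^ 2) < profile q ((1 - q) * y ^ 2) → density q x < density q y := by
    intro x hx y hy hxy
    rw [density_eq_profile hq hx, density_eq_profile hq hy]
    exact mul_lt_mul_of_pos_left hxy hC
  have hsq : ∀ x y : ℝ, |x| < |y| → (1 - q) * x ^ 2 < (1 - q) * y ^ 2 := fun x y hxy =>
    mul_lt_mul_of_pos_left (sq_lt_sq.2 hxy) h1
  have hle : ∀ x y : ℝ, |x| ≤ |y| → (1 - q) * x ^ 2 ≤ (1 - q) * y ^ 2 := fun x y hxy =>
    mul_le_mul_of_nonneg_left (sq_le_sq.2 hxy) h1.le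
  have hin : ∀ x, |x| ≤ m → (1 - q) * x ^ 2 ∈ Icc 0 τ := by
    intro x hx
    refine ⟨by positivity, ?_⟩
    rw [← hm2]
    exact hle x m (by rwa [abs_of_pos hm0])
  have hout : ∀ x, m ≤ |x| → |x| ≤ R → (1 - q) * x ^ 2 ∈ Icc τ 4 := by
    intro x hx hx'
    rw [← hm2, ← hR2]
    exact ⟨hle m x (by rwa [abs_of_pos hm0]), hle x R (by rwa [abs_of_pos hR0])⟩
  refine ⟨-m, 0, m, ?_, ?_, by linarith, hm0, ?_, ?_, ?_, ?_⟩
  · rw [interior_Icc]; exact ⟨by linarith, by linarith⟩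
  · rw [interior_Icc]; exact ⟨by linarith, by linarith⟩
  · rintro x ⟨hx, hxm⟩ y ⟨hy, hym⟩ hxy
    rw [mem_Iic] at hxm hym
    have ax : |x| = -x := abs_of_nonpos (by linarith)
    have ay : |y| = -y := abs_of_nonpos (by linarith)
    exact hlt x hx y hy (hanti (hout y (by linarith) (by linarith [hy.1]))
      (hout x (by linarith) (by linarith [hx.1])) (hsq y x (by linarith)))
  · rintro x ⟨hx, hxm⟩ y ⟨hy, hym⟩ hxy
    have ax : |x| = -x := abs_of_nonpos (by linarith [hxm.2])
    have ay : |y| = -y := abs_of_nonpos (by linarith [hym.2])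
    exact hlt y hy x hx (hmono (hin y (by linarith [hym.1])) (hin x (by linarith [hxm.1]))
      (hsq y x (by linarith)))
  · rintro x ⟨hx, hxm⟩ y ⟨hy, hym⟩ hxy
    have ax : |x| = x := abs_of_nonneg (by linarith [hxm.1])
    have ay : |y| = y := abs_of_nonneg (by linarith [hym.1])
    exact hlt x hx y hy (hmono (hin x (by linarith [hxm.2])) (hin y (by linarith [hym.2]))
      (hsq x y (by linarith)))
  · rintro x ⟨hx, hxm⟩ y ⟨hy, hym⟩ hxy
    rw [mem_Ici] at hxm hym
    have ax : |x| = x := abs_of_nonneg (by linarith)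
    have ay : |y| = y := abs_of_nonneg (by linarith)
    exact hlt y hy x hx (hanti (hout x (by linarith) (by linarith [hx.2]))
      (hout y (by linarith) (by linarith [hy.2])) (hsq x y (by linarith)))

/-! ### The slope of the profile at the origin -/

/-- The Lambert series `∑_{k≥1} q^k / (1+q^k)²`. -/
noncomputable def lambertSum (q : ℝ) : ℝ := ∑' k : ℕ, q ^ (k + 1) / (1 + q ^ (k + 1)) ^ 2

theorem abs_pow_succ_le {q : ℝ} (hq : q ∈ Ioo (-1 : ℝ) 1) (k : ℕ) : |q ^ (k + 1)| ≤ |q| := by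
  rw [abs_pow]
  exact pow_le_of_le_one (abs_nonneg q) (abs_lt.2 hq).le (Nat.succ_ne_zero k)

theorem one_sub_abs_sq_le {q : ℝ} (hq : q ∈ Ioo (-1 : ℝ) 1) (k : ℕ) :
    (1 - |q|) ^ 2 ≤ (1 + q ^ (k + 1)) ^ 2 := by
  have h := abs_le.1 (abs_pow_succ_le hq k)
  have h1 := abs_lt.2 hq
  exact pow_le_pow_left₀ (by linarith) (by linarith [h.1]) 2

/-- Termwise differentiation of the sum of the logarithms of the factors. -/
theorem hasDerivAt_logProfile {q : ℝ} (hq : q ∈ Ioo (-1 : ℝ) 1) :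
    HasDerivAt (logProfile q) (-(1 / 8) - lambertSum q) 0 := by
  have hq1 : |q| < 1 := abs_lt.2 hq
  set c := (1 - |q|) ^ 2 with hc
  have hc0 : 0 < c := pow_pos (by linarith) 2
  -- On `|t| < c/2` every factor is at least `c/2`.
  have hfac : ∀ k : ℕ, ∀ t ∈ Metric.ball (0 : ℝ) (c / 2),
      c / 2 ≤ (1 + q ^ (k + 1)) ^ 2 - t * q ^ (k + 1) := by
    intro k t ht
    rw [mem_ball_zero_iff, Real.norm_eq_abs] at ht
    have h1 := one_sub_abs_sq_le hq k
    have h2 : |t * q ^ (k + 1)| ≤ c / 2 * 1 := by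
      rw [abs_mul]
      exact mul_le_mul ht.le ((abs_pow_succ_le hq k).trans hq1.le) (abs_nonneg _) (by positivity)
    linarith [le_abs_self (t * q ^ (k + 1))]
  have hsum : HasDerivAt (fun t => ∑' k : ℕ, Real.log ((1 + q ^ (k + 1)) ^ 2 - t * q ^ (k + 1)))
      (∑' k : ℕ, -(q ^ (k + 1)) / ((1 + q ^ (k + 1)) ^ 2 - 0 * q ^ (k + 1))) 0 := by
    refine hasDerivAt_tsum_of_isPreconnected
      (g := fun (k : ℕ) t => Real.log ((1 + q ^ (k + 1)) ^ 2 - t * q ^ (k + 1)))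
      (g' := fun (k : ℕ) t => -(q ^ (k + 1)) / ((1 + q ^ (k + 1)) ^ 2 - t * q ^ (k + 1)))
      (u := fun k => |q ^ (k + 1)| / (c / 2))
      (t := Metric.ball 0 (c / 2)) ((summable_pow_succ hq).abs.div_const _) Metric.isOpen_ball
      (convex_ball 0 _).isPreconnected (fun k t ht => ?_) (fun k t ht => ?_)
      (Metric.mem_ball_self (by positivity)) (summable_log_factor hq 0)
      (Metric.mem_ball_self (by positivity))
    · have h := hfac k t ht
      refine HasDerivAt.log ?_ (by linarith)
      simpa using ((hasDerivAt_id t).mul_const (q ^ (k + 1))).const_sub ((1 + q ^ (k + 1)) ^ 2)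
    · have h := hfac k t ht
      rw [norm_div, norm_neg, Real.norm_eq_abs, Real.norm_of_nonneg (by linarith)]
      exact div_le_div_of_nonneg_left (abs_nonneg _) (by positivity) h
  have hlog : HasDerivAt (fun t : ℝ => 1 / 2 * Real.log (4 - t)) (1 / 2 * (-1 / (4 - 0))) 0 :=
    (((hasDerivAt_id (0 : ℝ)).const_sub 4).log (by norm_num)).const_mul _
  have hv : 1 / 2 * (-1 / (4 - 0)) +
      ∑' k : ℕ, -(q ^ (k + 1)) / ((1 + q ^ (k + 1)) ^ 2 - 0 * q ^ (k + 1)) =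
        -(1 / 8) - lambertSum q := by
    simp only [zero_mul, sub_zero, neg_div, tsum_neg, lambertSum]
    ring
  rw [← hv]
  exact hlog.add hsum

/-- A positive slope at `0` makes the profile exceed its value at `0`. -/
theorem exists_profile_zero_lt {q : ℝ} (hq : q ∈ Ioo (-1 : ℝ) 1) (h : 1 / 8 + lambertSum q < 0) :
    ∃ t ∈ Ico (0 : ℝ) 4, profile q 0 < profile q t := by
  have hslope := hasDerivAt_iff_tendsto_slope.1 (hasDerivAt_logProfile hq)
  have h1 : ∀ᶠ t in 𝓝[>] (0 : ℝ), 0 < slope (logProfile q) 0 t :=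
    (hslope.mono_left (nhdsWithin_mono _ fun x hx => ne_of_gt hx)).eventually
      (lt_mem_nhds (by linarith))
  have h2 : ∀ᶠ t in 𝓝[>] (0 : ℝ), t ∈ Ioo (0 : ℝ) 4 := Ioo_mem_nhdsGT (by norm_num)
  obtain ⟨t, ht1, ht2⟩ := (h1.and h2).exists
  refine ⟨t, ⟨ht2.1.le, ht2.2⟩, ?_⟩
  rw [← exp_logProfile hq ⟨le_rfl, by norm_num⟩, ← exp_logProfile hq ⟨ht2.1.le, ht2.2⟩,
    Real.exp_lt_exp]
  exact (slope_pos_iff_of_le ht2.1.le).1 ht1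

theorem tendsto_cos_sub_one_div_sq (m : ℝ) :
    Tendsto (fun φ : ℝ => (Real.cos (m * φ) - 1) / φ ^ 2) (𝓝[≠] 0) (𝓝 (-(m ^ 2 / 2))) := by
  have h : HasDerivAt (fun φ : ℝ => Real.sin (m / 2 * φ)) (m / 2) 0 := by
    have := (((hasDerivAt_id (0 : ℝ)).const_mul (m / 2))).sin
    simpa using this
  -- `cos x - 1 = -2 sin²(x/2)`
  have h2 := (((hasDerivAt_iff_tendsto_slope.1 h).pow 2).const_mul (-2))
  rw [show -2 * (m / 2) ^ 2 = -(m ^ 2 / 2) by ring] at h2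
  refine h2.congr fun φ => ?_
  rw [slope_def_field, show m * φ = 2 * (m / 2 * φ) by ring, Real.cos_two_mul, Real.cos_sq']
  simp only [mul_zero, Real.sin_zero, sub_zero]
  ring

/-- The second-order Taylor coefficient of the even function `thetaSeries q` at `0`; it is
`-1/2` times the series `∑ (2k+1)² q^(k(k+1)/2)`. The quotients `(cos(mφ) - 1)/φ²` are bounded by
`m²`, so the limit may be taken termwise. -/
theorem tendsto_thetaSeries_sub_div_sq {q : ℝ} (hq : q ∈ Ioo (-1 : ℝ) 1) :
    Tendsto (fun φ => (thetaSeries q φ - thetaSeries q 0) / φ ^ 2) (𝓝[≠] 0)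
      (𝓝 (∑' k : ℕ, q ^ (Nat.choose (k + 1) 2) * -((2 * (k : ℝ) + 1) ^ 2 / 2))) := by
  have hs : ∀ φ : ℝ, Summable fun k : ℕ =>
      q ^ (Nat.choose (k + 1) 2) * Real.cos ((2 * k + 1) * φ) := fun φ => by
    refine Summable.of_norm_bounded (summable_abs_pow_choose hq) fun k => ?_
    rw [Real.norm_eq_abs, abs_mul]
    exact mul_le_of_le_one_right (abs_nonneg _) (Real.abs_cos_le_one _)
  have heq : ∀ φ, (thetaSeries q φ - thetaSeries q 0) / φ ^ 2 = ∑' k : ℕ,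
      q ^ (Nat.choose (k + 1) 2) * ((Real.cos ((2 * k + 1) * φ) - 1) / φ ^ 2) := by
    intro φ
    rw [thetaSeries, thetaSeries, ← (hs φ).tsum_sub (hs 0), ← tsum_div_const]
    refine tsum_congr fun k => ?_
    rw [mul_zero, Real.cos_zero]
    ring
  simp only [heq]
  have hbound : Summable fun k : ℕ => |(2 * (k : ℝ) + 1) ^ 2 * q ^ (Nat.choose (k + 1) 2)| :=
    (summable_mul_pow_choose hq fun k => (abs_of_nonneg (by positivity)).le).abs
  refine tendsto_tsum_of_dominated_convergence hbound
    (fun k => (tendsto_cos_sub_one_div_sq _).const_mul _) ?_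
  refine Eventually.of_forall fun φ k => ?_
  rw [Real.norm_eq_abs, abs_mul, abs_mul, mul_comm]
  refine mul_le_mul_of_nonneg_right ?_ (abs_nonneg _)
  rw [abs_div, abs_of_nonneg (sq_nonneg φ), abs_of_nonneg (sq_nonneg (2 * (k : ℝ) + 1))]
  refine div_le_of_le_mul₀ (sq_nonneg φ) (sq_nonneg _) ?_
  have h1 := Real.one_sub_sq_div_two_le_cos (x := (2 * (k : ℝ) + 1) * φ)
  have h2 := Real.cos_le_one ((2 * (k : ℝ) + 1) * φ)
  rw [abs_of_nonpos (by linarith)]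
  nlinarith [sq_nonneg ((2 * (k : ℝ) + 1) * φ)]

/-- The slope of the profile at `0`, read off from the theta series and from the product. -/
theorem tsum_sq_mul_pow_choose {q : ℝ} (hq : q ∈ Ioo (-1 : ℝ) 1) :
    ∑' k : ℕ, (2 * (k : ℝ) + 1) ^ 2 * q ^ (Nat.choose (k + 1) 2) =
      8 * thetaSeries q 0 * (1 / 8 + lambertSum q) := by
  set E : ℝ → ℝ := fun t => Real.exp (logProfile q t) with hE
  have hP := qPochhammerInf_self_pos hq
  set K := 2 / qPochhammerInf q q with hK
  have hK0 : 0 < K := by positivity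
  have hE0 : E 0 = K * thetaSeries q 0 := by
    have := profile_four_mul_sin_sq hq (φ := 0)
      ⟨by linarith [Real.pi_pos], by linarith [Real.pi_pos]⟩
    simp only [Real.sin_zero] at this
    norm_num at this
    rw [hE]
    simp only
    rw [exp_logProfile hq ⟨le_rfl, by norm_num⟩, this]
  have hd : HasDerivAt E (E 0 * (-(1 / 8) - lambertSum q)) 0 := (hasDerivAt_logProfile hq).exp
  have hcont : Tendsto (dslope E 0) (𝓝 0) (𝓝 (E 0 * (-(1 / 8) - lambertSum q))) := by
    have := (continuousAt_dslope_same.2 hd.differentiableAt).tendsto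
    rwa [dslope_same, hd.deriv] at this
  have hsin : Tendsto (fun φ : ℝ => Real.sin φ / φ) (𝓝[≠] 0) (𝓝 1) := by
    have h := hasDerivAt_iff_tendsto_slope.1 (Real.hasDerivAt_sin 0)
    rw [Real.cos_zero] at h
    refine h.congr fun φ => ?_
    rw [slope_def_field, Real.sin_zero, sub_zero, sub_zero]
  have hsq : Tendsto (fun φ : ℝ => 4 * Real.sin φ ^ 2) (𝓝[≠] 0) (𝓝 0) := by
    have : Continuous fun φ : ℝ => 4 * Real.sin φ ^ 2 := by fun_prop
    have := (this.tendsto 0).mono_left (nhdsWithin_le_nhds (s := {0}ᶜ))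
    simpa using this
  have h1 := ((hsin.pow 2).const_mul 4).mul (hcont.comp hsq)
  have h2 := (tendsto_thetaSeries_sub_div_sq hq).const_mul K
  have hev : (fun φ : ℝ => 4 * (Real.sin φ / φ) ^ 2 * (dslope E 0 ∘ fun φ => 4 * Real.sin φ ^ 2) φ)
      =ᶠ[𝓝[≠] 0] fun φ => K * ((thetaSeries q φ - thetaSeries q 0) / φ ^ 2) := by
    have hnear : ∀ᶠ φ in 𝓝[≠] (0 : ℝ), φ ∈ Ioo (-(1 : ℝ)) 1 :=
      nhdsWithin_le_nhds (Ioo_mem_nhds (by norm_num) (by norm_num))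
    filter_upwards [hnear, hsq.eventually (gt_mem_nhds (show (0 : ℝ) < 4 by norm_num))]
      with φ hφ h4
    have hpi := Real.pi_gt_three
    have h5 := profile_four_mul_sin_sq hq (φ := φ) ⟨by linarith [hφ.1], by linarith [hφ.2]⟩
    rw [← exp_logProfile hq ⟨by positivity, h4⟩] at h5
    have h6 := sub_smul_dslope E 0 (4 * Real.sin φ ^ 2)
    rw [hE0, sub_zero, smul_eq_mul] at h6
    simp only [Function.comp]
    calc _ = (4 * Real.sin φ ^ 2 * dslope E 0 (4 * Real.sin φ ^ 2)) / φ ^ 2 := by ring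
      _ = (K * thetaSeries q φ - K * thetaSeries q 0) / φ ^ 2 := by rw [h6, ← h5]
      _ = _ := by ring
  have h3 := tendsto_nhds_unique (h1.congr' hev) h2
  have h4 : ∑' k : ℕ, q ^ (Nat.choose (k + 1) 2) * -((2 * (k : ℝ) + 1) ^ 2 / 2) =
      -(1 / 2) * ∑' k : ℕ, (2 * (k : ℝ) + 1) ^ 2 * q ^ (Nat.choose (k + 1) 2) := by
    rw [← tsum_mul_left]
    exact tsum_congr fun k => by ring
  rw [h4, hE0] at h3
  refine mul_left_cancel₀ hK0.ne' ?_
  linear_combination 2 * h3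

theorem thetaSeries_zero_pos {q : ℝ} (hq : q ∈ Ioo (-1 : ℝ) 1) : 0 < thetaSeries q 0 := by
  have h := profile_four_mul_sin_sq hq (φ := 0)
    ⟨by linarith [Real.pi_pos], by linarith [Real.pi_pos]⟩
  simp only [Real.sin_zero] at h
  norm_num at h
  have h0 := profile_pos hq (t := 0) ⟨le_rfl, by norm_num⟩
  rw [h] at h0
  have := qPochhammerInf_self_pos hq
  exact pos_of_mul_pos_right h0 (by positivity)

/-! ### Monotonicity of the Lambert series on `(-1, 0]` -/

/-- The derivative is positive because `(k+1)s ≤ k + s^(k+1)` by Bernoulli's inequality. -/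
theorem strictMonoOn_pow_add_sq_sub {k : ℕ} (hk : k ≠ 0) :
    StrictMonoOn (fun s : ℝ => s ^ k + (s ^ k) ^ 2 - s ^ (k + 1)) (Icc 0 1) := by
  obtain ⟨n, rfl⟩ := Nat.exists_eq_succ_of_ne_zero hk
  simp only [Nat.succ_eq_add_one, ← pow_mul]
  refine strictMonoOn_of_deriv_pos (convex_Icc 0 1) (by fun_prop) fun s hs => ?_
  rw [interior_Icc] at hs
  have hd : HasDerivAt (fun s : ℝ => s ^ (n + 1) + s ^ ((n + 1) * 2) - s ^ (n + 1 + 1)) _ s :=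
    ((hasDerivAt_pow (n + 1) s).add (hasDerivAt_pow ((n + 1) * 2) s)).sub
      (hasDerivAt_pow (n + 1 + 1) s)
  rw [hd.deriv]
  have hb := one_add_mul_le_pow (show (-2 : ℝ) ≤ s - 1 by linarith [hs.1]) (n + 2)
  have hp := pow_pos hs.1 n
  rw [show 1 + (s - 1) = s by ring] at hb
  push_cast at hb ⊢
  have e2 : (n + 1) * 2 - 1 = n + (n + 1) := by omega
  rw [e2]
  have h1 : s ^ (n + 2) < 2 * (n + 1) * s ^ (n + 1) := by
    rw [pow_succ' s (n + 1)]
    have : (0 : ℝ) ≤ n := n.cast_nonneg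
    have := pow_pos hs.1 (n + 1)
    exact mul_lt_mul_of_pos_right (by nlinarith [hs.2]) this
  have h2 : 0 < s ^ n * ((n + 1) + 2 * (n + 1) * s ^ (n + 1) - (n + 2) * s) :=
    mul_pos hp (by nlinarith)
  calc (0 : ℝ) < _ := h2
    _ = _ := by ring

/-- `y/(1-y)²` grows at least as fast as `y + y²` on `[0, 1)`. -/
theorem add_sq_sub_le_div_one_sub_sq {y y' : ℝ} (hy : 0 ≤ y) (h : y ≤ y') (hy' : y' < 1) :
    (y' + y' ^ 2) - (y + y ^ 2) ≤ y' / (1 - y') ^ 2 - y / (1 - y) ^ 2 := by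
  have e : ∀ z : ℝ, z < 1 → z / (1 - z) ^ 2 =
      z + z ^ 2 + z ^ 2 * (1 / (1 - z) ^ 2 + z / (1 - z)) := by
    intro z hz
    have : 1 - z ≠ 0 := by linarith
    field_simp
    ring
  have h1 : 0 < 1 - y' := by linarith
  have h2 : 1 - y' ≤ 1 - y := by linarith
  have : y ^ 2 * (1 / (1 - y) ^ 2 + y / (1 - y)) ≤
      y' ^ 2 * (1 / (1 - y') ^ 2 + y' / (1 - y')) := by
    have h3 : 0 < 1 - y := by linarith
    have h4 : 0 ≤ y' := hy.trans h
    gcongr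
  rw [e y (by linarith), e y' hy']
  linarith

/-- `z/(1+z)²` grows at most as fast as `z` on `[0, ∞)`. -/
theorem div_one_add_sq_sub_le {z z' : ℝ} (hz : 0 ≤ z) (h : z ≤ z') :
    z' / (1 + z') ^ 2 - z / (1 + z) ^ 2 ≤ z' - z := by
  have h1 : z * (1 - 1 / (1 + z) ^ 2) ≤ z' * (1 - 1 / (1 + z') ^ 2) := by
    have h2 : 1 / (1 + z') ^ 2 ≤ 1 / (1 + z) ^ 2 := by gcongr
    have h3 : 1 / (1 + z) ^ 2 ≤ 1 := by
      rw [div_le_one (by positivity)]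
      nlinarith
    exact mul_le_mul h (by linarith) (by linarith) (by linarith)
  have e : ∀ w : ℝ, w * (1 - 1 / (1 + w) ^ 2) = w - w / (1 + w) ^ 2 := fun w => by ring
  rw [e, e] at h1
  linarith

/-- The two growth estimates reduce the claim to the monotonicity of `s^k + s^(2k) - s^(k+1)`. -/
theorem lambert_pair_lt {r s : ℝ} (hs : 0 ≤ s) (hsr : s < r) (hr : r < 1) {k : ℕ} (hk : k ≠ 0) :
    s ^ k / (1 - s ^ k) ^ 2 - s ^ (k + 1) / (1 + s ^ (k + 1)) ^ 2 <
      r ^ k / (1 - r ^ k) ^ 2 - r ^ (k + 1) / (1 + r ^ (k + 1)) ^ 2 := by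
  have h1 := add_sq_sub_le_div_one_sub_sq (pow_nonneg hs k) (pow_le_pow_left₀ hs hsr.le k)
    (pow_lt_one₀ (hs.trans hsr.le) hr hk)
  have h2 := div_one_add_sq_sub_le (pow_nonneg hs (k + 1)) (pow_le_pow_left₀ hs hsr.le (k + 1))
  have h3 := strictMonoOn_pow_add_sq_sub hk ⟨hs, (hsr.trans hr).le⟩ ⟨hs.trans hsr.le, hr.le⟩ hsr
  simp only at h3
  linarith

theorem summable_lambert {q : ℝ} (hq : q ∈ Ioo (-1 : ℝ) 1) :
    Summable (fun k : ℕ => q ^ (k + 1) / (1 + q ^ (k + 1)) ^ 2) := by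
  have hc0 : 0 < (1 - |q|) ^ 2 := pow_pos (by linarith [abs_lt.2 hq]) 2
  refine Summable.of_norm_bounded
    ((summable_pow_succ hq).abs.div_const ((1 - |q|) ^ 2)) fun k => ?_
  rw [norm_div, Real.norm_eq_abs, Real.norm_of_nonneg (sq_nonneg _)]
  exact div_le_div_of_nonneg_left (abs_nonneg _) hc0 (one_sub_abs_sq_le hq k)

/-- Grouping the terms of odd index `k` with those of index `k + 1` makes every group increasing. -/
theorem lambertSum_strictMonoOn : StrictMonoOn lambertSum (Ioc (-1) 0) := by
  intro q hq p hp hqp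
  have hpair : ∀ x ∈ Ioc (-1 : ℝ) 0, ∃ f : ℕ → ℝ, Summable f ∧ lambertSum x = ∑' j, f j ∧
      ∀ j, f j = -((-x) ^ (2 * j + 1) / (1 - (-x) ^ (2 * j + 1)) ^ 2 -
        (-x) ^ (2 * j + 1 + 1) / (1 + (-x) ^ (2 * j + 1 + 1)) ^ 2) := by
    intro x hx
    have hs := summable_lambert (q := x) ⟨hx.1, by linarith [hx.2]⟩
    have he : Summable fun j : ℕ => x ^ (2 * j + 1) / (1 + x ^ (2 * j + 1)) ^ 2 :=
      hs.comp_injective (i := fun j : ℕ => 2 * j) fun a b h => by simpa using h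
    have ho : Summable fun j : ℕ => x ^ (2 * j + 1 + 1) / (1 + x ^ (2 * j + 1 + 1)) ^ 2 :=
      hs.comp_injective (i := fun j : ℕ => 2 * j + 1) fun a b h => by simpa using h
    refine ⟨fun j => x ^ (2 * j + 1) / (1 + x ^ (2 * j + 1)) ^ 2 +
      x ^ (2 * j + 1 + 1) / (1 + x ^ (2 * j + 1 + 1)) ^ 2, he.add ho, ?_, fun j => ?_⟩
    · rw [he.tsum_add ho]
      exact (tsum_even_add_odd (f := fun k : ℕ => x ^ (k + 1) / (1 + x ^ (k + 1)) ^ 2) he ho).symm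
    · have h1 := (show Odd (2 * j + 1) from ⟨j, rfl⟩).neg_pow x
      have h2 := (show Even (2 * j + 1 + 1) from ⟨j + 1, by ring⟩).neg_pow x
      rw [h1, h2, sub_neg_eq_add]
      ring
  obtain ⟨f, hf, hfs, hfe⟩ := hpair q hq
  obtain ⟨g, hg, hgs, hge⟩ := hpair p hp
  have hlt : ∀ j, f j < g j := by
    intro j
    have := lambert_pair_lt (r := -q) (s := -p) (by linarith [hp.2]) (by linarith)
      (by linarith [hq.1]) (k := 2 * j + 1) (by omega)
    rw [hfe, hge]
    linarith
  rw [hfs, hgs]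
  exact Summable.tsum_lt_tsum (i := 0) (fun j => (hlt j).le) (hlt 0) hf hg

/-! ### The critical parameter -/

/-- The series `∑_{k≥0} (2k+1)² q^(k(k+1)/2)` whose largest zero is the critical parameter. -/
noncomputable def criticalSeries (q : ℝ) : ℝ :=
  ∑' k : ℕ, (2 * (k : ℝ) + 1) ^ 2 * q ^ (Nat.choose (k + 1) 2)

theorem mul_succ_div_two_eq_choose (k : ℕ) : k * (k + 1) / 2 = Nat.choose (k + 1) 2 := by
  rw [Nat.choose_two_right, Nat.add_sub_cancel, mul_comm]

theorem summable_criticalSeries {q : ℝ} (hq : q ∈ Ioo (-1 : ℝ) 1) :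
    Summable (fun k : ℕ => (2 * (k : ℝ) + 1) ^ 2 * q ^ (Nat.choose (k + 1) 2)) :=
  summable_mul_pow_choose hq fun k => (abs_of_nonneg (by positivity)).le

theorem hasSum_zero_iff_criticalSeries_eq_zero {q : ℝ} (hq : q ∈ Ioo (-1 : ℝ) 1) :
    HasSum (fun k : ℕ => (2 * (k : ℝ) + 1) ^ 2 * q ^ (k * (k + 1) / 2)) 0 ↔
      criticalSeries q = 0 := by
  simp only [mul_succ_div_two_eq_choose]
  exact (summable_criticalSeries hq).hasSum_iff

theorem continuousOn_criticalSeries : ContinuousOn criticalSeries (Icc (-0.108) (-0.107)) := by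
  refine continuousOn_tsum (fun k => by fun_prop)
    (summable_linear_sq_mul_geometric (r := 1 / 2) (by norm_num) (by norm_num)) fun k q hq => ?_
  have hq1 : q ∈ Ioo (-1 : ℝ) 1 := ⟨by linarith [hq.1], by linarith [hq.2]⟩
  rw [norm_mul, Real.norm_of_nonneg (by positivity), Real.norm_eq_abs]
  refine mul_le_mul_of_nonneg_left ((abs_pow_choose_le hq1 k).trans ?_) (by positivity)
  exact pow_le_pow_left₀ (abs_nonneg q)
    (abs_le.2 ⟨by linarith [hq.1], by linarith [hq.2]⟩) k

theorem add_six_le_choose (k : ℕ) : k + 6 ≤ Nat.choose (k + 4) 2 := by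
  induction k with
  | zero => decide
  | succ k ih =>
    rw [show k + 1 + 4 = k + 4 + 1 by ring, choose_succ_two]
    omega

theorem two_mul_add_seven_le (k : ℕ) : 2 * (k : ℝ) + 7 ≤ 7 * 2 ^ k := by
  induction k with
  | zero => norm_num
  | succ k ih =>
    have : (0 : ℝ) ≤ k := k.cast_nonneg
    push_cast
    rw [pow_succ]
    linarith

/-- Near the origin the series is its first three terms up to a small error: with `|q| ≤ 0.108`
the remaining terms are dominated by `49 |q|^6 (4|q|)^k`. -/
theorem abs_criticalSeries_sub_le {q : ℝ} (hq : |q| ≤ 0.108) :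
    |criticalSeries q - (1 + 9 * q + 25 * q ^ 3)| ≤ 0.001 := by
  have hq1 : q ∈ Ioo (-1 : ℝ) 1 := abs_lt.1 (by linarith)
  have hs := summable_criticalSeries hq1
  have hsplit := hs.sum_add_tsum_nat_add 3
  have hfirst : ∑ k ∈ Finset.range 3, (2 * (k : ℝ) + 1) ^ 2 * q ^ (Nat.choose (k + 1) 2) =
      1 + 9 * q + 25 * q ^ 3 := by
    simp [Finset.sum_range_succ]
    norm_num
  rw [criticalSeries, ← hsplit, hfirst, add_sub_cancel_left]
  have hgeom : HasSum (fun k : ℕ => 49 * (0.108 : ℝ) ^ 6 * (1 / 2) ^ k)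
      (49 * (0.108 : ℝ) ^ 6 * 2) := hasSum_geometric_two.mul_left _
  have hle : ‖∑' k : ℕ, (2 * ((k + 3 : ℕ) : ℝ) + 1) ^ 2 * q ^ (Nat.choose (k + 3 + 1) 2)‖ ≤
      49 * (0.108 : ℝ) ^ 6 * 2 := by
    refine tsum_of_norm_bounded hgeom fun k => ?_
    have h1 : (2 * ((k + 3 : ℕ) : ℝ) + 1) ^ 2 ≤ 49 * 4 ^ k := by
      calc (2 * ((k + 3 : ℕ) : ℝ) + 1) ^ 2 = (2 * (k : ℝ) + 7) ^ 2 := by push_cast; ring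
        _ ≤ (7 * 2 ^ k) ^ 2 := pow_le_pow_left₀ (by positivity) (two_mul_add_seven_le k) 2
        _ = 49 * 4 ^ k := by rw [mul_pow, ← pow_mul, mul_comm k 2, pow_mul]; norm_num
    have h2 : |q ^ (Nat.choose (k + 3 + 1) 2)| ≤ (0.108 : ℝ) ^ 6 * (1 / 8) ^ k := by
      rw [abs_pow]
      calc |q| ^ (Nat.choose (k + 4) 2) ≤ |q| ^ (k + 6) :=
            pow_le_pow_of_le_one (abs_nonneg q) (by linarith) (add_six_le_choose k)
        _ = |q| ^ 6 * |q| ^ k := by ring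
        _ ≤ (0.108 : ℝ) ^ 6 * (1 / 8) ^ k := by
            have : |q| ≤ 1 / 8 := by linarith
            gcongr
    rw [norm_mul, Real.norm_of_nonneg (sq_nonneg _), Real.norm_eq_abs]
    calc _ ≤ 49 * 4 ^ k * ((0.108 : ℝ) ^ 6 * (1 / 8) ^ k) := by gcongr
      _ = 49 * (0.108 : ℝ) ^ 6 * (4 * (1 / 8)) ^ k := by rw [mul_pow]; ring
      _ = _ := by norm_num
  rw [Real.norm_eq_abs] at hle
  exact hle.trans (by norm_num)

theorem criticalSeries_pos {q : ℝ} (h1 : -0.107 ≤ q) (h2 : q ≤ 0) : 0 < criticalSeries q := by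
  have h := (abs_le.1 (abs_criticalSeries_sub_le (q := q) (abs_le.2 ⟨by linarith, by linarith⟩))).1
  have h3 : (-0.107 : ℝ) ^ 3 ≤ q ^ 3 := Odd.pow_le_pow (by decide) |>.2 h1
  norm_num at h h1 h3
  linarith

theorem criticalSeries_neg : criticalSeries (-0.108) < 0 := by
  have h := (abs_le.1 (abs_criticalSeries_sub_le (q := -0.108) (by norm_num [abs_le]))).2
  norm_num at h ⊢
  linarith

/-- At `q₀` the Lambert series equals `-1/8`, so it is smaller for `q < q₀`. -/
theorem isBimodalOn_density_of_lt {q q₀ : ℝ} (hq₀ : q₀ ∈ Ioc (-1 : ℝ) 0)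
    (h0 : criticalSeries q₀ = 0) (hq : q ∈ Ioo (-1 : ℝ) q₀) :
    IsBimodalOn (density q) (Icc (-(2 / √(1 - q))) (2 / √(1 - q))) := by
  have hq₀' : q₀ ∈ Ioo (-1 : ℝ) 1 := ⟨hq₀.1, by linarith [hq₀.2]⟩
  have h1 := tsum_sq_mul_pow_choose hq₀'
  rw [← criticalSeries, h0] at h1
  have h2 : 1 / 8 + lambertSum q₀ = 0 :=
    (mul_eq_zero.1 h1.symm).resolve_left (by linarith [thetaSeries_zero_pos hq₀'])
  have h3 := lambertSum_strictMonoOn ⟨hq.1, by linarith [hq.2, hq₀.2]⟩ hq₀ hq.2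
  have hq' : q ∈ Ioo (-1 : ℝ) 1 := ⟨hq.1, by linarith [hq.2, hq₀.2]⟩
  exact isBimodalOn_density hq' (exists_profile_zero_lt hq' (by linarith))

/-- On `[-0.108, -0.107]` the zeros of the series form a nonempty compact set, whose greatest
element is `q₀`; to the right of `-0.107` the series is positive where it converges. -/
theorem exists_critical_parameter : ∃ q₀ : ℝ,
    IsGreatest {q : ℝ | HasSum (fun k : ℕ => (2 * (k : ℝ) + 1) ^ 2 * q ^ (k * (k + 1) / 2)) 0} q₀ ∧
      -0.108 < q₀ ∧ q₀ < -0.107 ∧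
      ∀ q ∈ Ioo (-1 : ℝ) q₀,
        IsBimodalOn (density q) (Icc (-(2 / √(1 - q))) (2 / √(1 - q))) := by
  have hpos : 0 < criticalSeries (-0.107) := criticalSeries_pos le_rfl (by norm_num)
  have hne : (Icc (-0.108 : ℝ) (-0.107) ∩ criticalSeries ⁻¹' {0}).Nonempty := by
    obtain ⟨q, hq, h0⟩ := intermediate_value_Icc (by norm_num) continuousOn_criticalSeries
      ⟨criticalSeries_neg.le, hpos.le⟩
    exact ⟨q, hq, h0⟩
  have hcl : IsClosed (Icc (-0.108 : ℝ) (-0.107) ∩ criticalSeries ⁻¹' {0}) :=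
    continuousOn_criticalSeries.preimage_isClosed_of_isClosed isClosed_Icc isClosed_singleton
  obtain ⟨q₀, ⟨⟨hl, hr⟩, h0⟩, hub⟩ :=
    (isCompact_Icc.of_isClosed_subset hcl inter_subset_left).exists_isGreatest hne
  rw [mem_preimage, mem_singleton_iff] at h0
  have hq₀ : q₀ ∈ Ioo (-1 : ℝ) 1 := ⟨by linarith, by linarith⟩
  refine ⟨q₀, ⟨(hasSum_zero_iff_criticalSeries_eq_zero hq₀).2 h0, ?_⟩, ?_, ?_, ?_⟩
  · intro q hq
    rw [mem_ofPred_eq] at hq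
    by_contra! hlt
    rcases le_or_gt 0 q with hq0 | hq0
    · -- For `q ≥ 0` all terms are nonnegative and the first one is `1`.
      have := le_hasSum hq 0 fun k _ => by positivity
      norm_num at this
    · rw [hasSum_zero_iff_criticalSeries_eq_zero ⟨by linarith, by linarith⟩] at hq
      rcases le_or_gt q (-0.107) with h | h
      · exact absurd (hub ⟨⟨by linarith, h⟩, hq⟩) (not_le.2 hlt)
      · exact (criticalSeries_pos h.le hq0.le).ne' hq
  · refine lt_of_le_of_ne hl fun h => criticalSeries_neg.ne ?_
    rw [h, h0]
  · refine lt_of_le_of_ne hr fun h => hpos.ne' ?_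
    rw [← h, h0]
  · exact fun q hq => isBimodalOn_density_of_lt ⟨hq₀.1, by linarith⟩ h0 hq

/-! ### The triple product identity in the variable of the density -/

theorem tripleProduct_rescaled {q : ℝ} (hq : q ∈ Ioo (-1 : ℝ) 1) {x : ℝ}
    (hx : x ∈ Icc (-(2 / √(1 - q))) (2 / √(1 - q))) :
    Multipliable (fun k : ℕ => (1 + q ^ (k + 1)) ^ 2 - (1 - q) * x ^ 2 * q ^ (k + 1)) ∧
      Summable (fun k : ℕ => (-1 : ℝ) ^ k * q ^ (Nat.choose (k + 1) 2) *
        (Polynomial.Chebyshev.U ℝ (2 * ((k : ℤ) + 1) - 2)).eval (x * √(1 - q) / 2)) ∧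
      qPochhammerInf q q *
          ∏' k : ℕ, ((1 + q ^ (k + 1)) ^ 2 - (1 - q) * x ^ 2 * q ^ (k + 1)) =
        ∑' k : ℕ, (-1 : ℝ) ^ k * q ^ (Nat.choose (k + 1) 2) *
          (Polynomial.Chebyshev.U ℝ (2 * ((k : ℤ) + 1) - 2)).eval (x * √(1 - q) / 2) := by
  have h1 : 0 < 1 - q := by linarith [hq.2]
  have hs : 0 < √(1 - q) := Real.sqrt_pos.2 h1
  have hy : |x * √(1 - q) / 2| ≤ 1 := by
    have := abs_le.2 hx
    rw [le_div_iff₀ hs] at this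
    rw [abs_div, abs_mul, abs_of_pos hs, abs_two]
    linarith
  have e : 4 * (x * √(1 - q) / 2) ^ 2 = (1 - q) * x ^ 2 := by
    rw [div_pow, mul_pow, Real.sq_sqrt h1.le]
    ring
  have eU : ∀ k : ℕ, 2 * ((k : ℤ) + 1) - 2 = 2 * (k : ℤ) := fun k => by ring
  have h := tripleProduct hq hy
  rw [e] at h
  simp only [eU]
  exact ⟨multipliable_factor hq _, summable_tripleProduct hq hy, h⟩

end QGaussian

theorem mainTheorem3 :
    (∀ q ∈ Set.Ioo (-1 : ℝ) 1,
      -- (i)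
      (∀ x ∈ Set.Icc (-(2 / √(1 - q))) (2 / √(1 - q)),
        Multipliable (fun k : ℕ => (1 + q ^ (k + 1)) ^ 2 - (1 - q) * x ^ 2 * q ^ (k + 1)) ∧
        Summable (fun k : ℕ => (-1 : ℝ) ^ k * q ^ (Nat.choose (k + 1) 2) *
          (Polynomial.Chebyshev.U ℝ (2 * ((k : ℤ) + 1) - 2)).eval (x * √(1 - q) / 2)) ∧
        QGaussian.qPochhammerInf q q *
            ∏' k : ℕ, ((1 + q ^ (k + 1)) ^ 2 - (1 - q) * x ^ 2 * q ^ (k + 1)) =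
          ∑' k : ℕ, (-1 : ℝ) ^ k * q ^ (Nat.choose (k + 1) 2) *
            (Polynomial.Chebyshev.U ℝ (2 * ((k : ℤ) + 1) - 2)).eval (x * √(1 - q) / 2)) ∧
      -- (ii)
      (Summable (fun k : ℕ => q ^ (Nat.choose (k + 1) 2)) ∧
        QGaussian.qPochhammerInf (-q) q * QGaussian.qPochhammerInf (q ^ 2) (q ^ 2) =
          ∑' k : ℕ, q ^ (Nat.choose (k + 1) 2)) ∧
      -- (iii)
      (Summable (fun k : ℕ => (-1 : ℝ) ^ (3 * (k + 1)) *
          (q ^ (Nat.choose (3 * (k + 1)) 2) + q ^ (Nat.choose (3 * (k + 1) + 1) 2))) ∧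
        QGaussian.qPochhammerInf (q ^ 3) (q ^ 3) =
          1 + ∑' k : ℕ, (-1 : ℝ) ^ (3 * (k + 1)) *
            (q ^ (Nat.choose (3 * (k + 1)) 2) + q ^ (Nat.choose (3 * (k + 1) + 1) 2))) ∧
      -- (iv)
      (Summable (fun k : ℕ => (-1 : ℝ) ^ ((k + 2) + 1) * (2 * ((k : ℝ) + 2) - 1) *
          q ^ (Nat.choose (k + 2) 2)) ∧
        QGaussian.qPochhammerInf q q ^ 3 =
          1 + ∑' k : ℕ, (-1 : ℝ) ^ ((k + 2) + 1) * (2 * ((k : ℝ) + 2) - 1) *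
            q ^ (Nat.choose (k + 2) 2)) ∧
      -- (v)
      (∀ n : ℕ, 1 ≤ n →
        QGaussian.qBinom q (2 * n) n =
          ∑ k ∈ Finset.Icc 1 n, (-1 : ℝ) ^ (k - 1) * (1 + q ^ k) * q ^ (Nat.choose k 2) *
            QGaussian.qBinom q (2 * n) (n - k))) ∧
    -- (vi)
    (∃ q₀ : ℝ,
      IsGreatest {q : ℝ | HasSum (fun k : ℕ => (2 * (k : ℝ) + 1) ^ 2 * q ^ (k * (k + 1) / 2)) 0} q₀ ∧
      -0.108 < q₀ ∧ q₀ < -0.107 ∧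
      ∀ q ∈ Set.Ioo (-1 : ℝ) q₀,
        QGaussian.IsBimodalOn (QGaussian.density q)
          (Set.Icc (-(2 / √(1 - q))) (2 / √(1 - q)))) := by
  exact ⟨fun q hq => ⟨fun x hx => QGaussian.tripleProduct_rescaled hq hx,
    QGaussian.gauss_triangular_series hq, QGaussian.euler_series_cube_base hq,
    QGaussian.jacobi_cube_series hq,
    fun n hn => QGaussian.qBinom_central hq n hn⟩, QGaussian.exists_critical_parameter⟩
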